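/- Let $B_n$ be the hyperoctahedral group of signed permutations of $[n]=\{1,\dots,n\}$, i.e. words $\sigma=\sigma_1\cdots\sigma_n$ with letters in $\{\pm1,\dots,\pm n\}$ such that $|\sigma_1|\cdots|\sigma_n|$ is a permutation of $[n]$. Let $\ell_B$ be the Coxeter length on $B_n$ with respect to the generators $s_0=(1,-1)$ and $s_i=(i,i+1)$, $1\le i\le n-1$. Let ${\rm neg}(\sigma)$ be the number of negative letters of $\sigma$ and let ${\rm fmaj}(\sigma)=2\,{\rm maj}(\sigma)+{\rm neg}(\sigma)$, where ${\rm maj}(\sigma)$ is the sum of all $i\in\{1,\dots,n-1\}$ with $\sigma_{i+1}\prec\sigma_i$ in the order $-1\prec-2\prec\cdots\prec-n\prec0\prec1\prec2\prec\cdots\prec n$. Let $\mathcal D^B_n$ be the set of $\sigma\in B_n$ with $\sigma_i\ne i$ for all $i\in[n]$. The derangement part $dp(\pi)$ of $\pi\in B_n$ is obtained by deleting all fixed points ($\pi_i=i$) from the word of $\pi$ and replacing the absolute values of the remaining $k$ letters by $1,\dots,k$ in an order-preserving way, keeping the signs; it is an element of $\mathcal D^B_k$. Put $[m]_q=1+q+\cdots+q^{m-1}$,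 $[m]_q!=[1]_q\cdots[m]_q$ and ${n\brack k}_q=\frac{[n]_q!}{[k]_q!\,[n-k]_q!}$. As identities of rational functions in $q$ over $\mathbb Q$: (i) for every $n\ge1$, $$\sum_{\sigma\in\mathcal D^B_n}(-1)^{\ell_B(\sigma)}q^{{\rm fmaj}(\sigma)}=[2]_q[4]_q\cdots[2n]_q\sum_{k=0}^n\frac{(-1)^kq^{2\binom k2}}{[2]_q[4]_q\cdots[2k]_q}\left(\frac{1-q}{1+q}\right)^{\lfloor\frac{n-k+1}{2}\rfloor};$$ (ii) for every $n\ge0$ and every $\pi\in B_n$, $\ell_B(\pi)\equiv\ell_B(dp(\pi))\pmod 2$; (iii) for all $0\le k\le n$ and every $\sigma\in\mathcal D^B_k$, $$\sum_{\pi\in B_n,\ dp(\pi)=\sigma}(-1)^{\ell_B(\pi)}q^{{\rm fmaj}(\pi)}=(-1)^{\ell_B(\sigma)}q^{{\rm fmaj}(\sigma)}{n\brack k}_{q^2}.$$ -/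

import Mathlib

/-- A signed permutation `σ` of `[n]`: the position `i : Fin n` stands for `i + 1 ∈ [n]`, the
permutation `|σ|` is `perm`, and `sgn i` is the sign of the letter at position `i`. -/
@[ext]
structure SignedPerm (n : ℕ) where
  perm : Equiv.Perm (Fin n)
  sgn : Fin n → ℤˣ

namespace SignedPerm

variable {n : ℕ}

/-- A signed permutation is the same as the pair consisting of `|σ|` and the signs. -/
def equivProd (n : ℕ) : SignedPerm n ≃ Equiv.Perm (Fin n) × (Fin n → ℤˣ) where
  toFun σ := (σ.perm, σ.sgn)
  invFun p := ⟨p.1, p.2⟩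
  left_inv _ := rfl
  right_inv _ := rfl

instance : DecidableEq (SignedPerm n) := (equivProd n).decidableEq

instance : Fintype (SignedPerm n) := Fintype.ofEquiv _ (equivProd n).symm

/-- The letter `σ_{i+1} ∈ {-n, …, -1, 1, …, n}` of the word `σ_1 ⋯ σ_n`. -/
def letter (σ : SignedPerm n) (i : Fin n) : ℤ := (σ.sgn i : ℤ) * ((σ.perm i : ℕ) + 1 : ℤ)

/-- The identity of the hyperoctahedral group `B_n`. -/
instance : One (SignedPerm n) := ⟨⟨1, fun _ => 1⟩⟩

/-- Composition `(σ τ)(i) = σ(τ(i))`, where `σ` is extended to negative arguments by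
`σ(-i) = -σ(i)`. -/
instance : Mul (SignedPerm n) :=
  ⟨fun σ τ => ⟨σ.perm * τ.perm, fun i => σ.sgn (τ.perm i) * τ.sgn i⟩⟩

instance : Inv (SignedPerm n) := ⟨fun σ => ⟨σ.perm⁻¹, fun i => (σ.sgn (σ.perm⁻¹ i))⁻¹⟩⟩

@[simp] theorem one_perm : (1 : SignedPerm n).perm = 1 := rfl
@[simp] theorem one_sgn (i : Fin n) : (1 : SignedPerm n).sgn i = 1 := rfl
@[simp] theorem mul_perm (σ τ : SignedPerm n) : (σ * τ).perm = σ.perm * τ.perm := rfl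
@[simp] theorem mul_sgn (σ τ : SignedPerm n) (i : Fin n) :
    (σ * τ).sgn i = σ.sgn (τ.perm i) * τ.sgn i := rfl
@[simp] theorem inv_perm (σ : SignedPerm n) : (σ⁻¹).perm = σ.perm⁻¹ := rfl
@[simp] theorem inv_sgn (σ : SignedPerm n) (i : Fin n) :
    (σ⁻¹).sgn i = (σ.sgn (σ.perm⁻¹ i))⁻¹ := rfl

/-- The hyperoctahedral group `B_n`. -/
instance : Group (SignedPerm n) :=
  Group.ofLeftAxioms
    (fun σ τ ρ => by ext i <;> simp [mul_assoc])
    (fun σ => by ext i <;> simp)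
    (fun σ => by ext i <;> simp)

/-- The sign change of the `i`-th letter; for the first position it is `s₀ = (1, -1)`. -/
def signChange (i : Fin n) : SignedPerm n := ⟨1, fun j => if j = i then -1 else 1⟩

/-- The transposition exchanging `i` and `j` (and `-i` and `-j`). -/
def transposition (i j : Fin n) : SignedPerm n := ⟨Equiv.swap i j, fun _ => 1⟩

/-- The Coxeter generators `s₀ = (1, -1)` and `s_i = (i, i + 1)`, `1 ≤ i ≤ n - 1`, of `B_n`. -/
def generators (n : ℕ) : Set (SignedPerm n) :=
  {s | (∃ i : Fin n, (i : ℕ) = 0 ∧ s = signChange i) ∨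
    ∃ i j : Fin n, (i : ℕ) + 1 = (j : ℕ) ∧ s = transposition i j}

/-- The length `ℓ_B(σ)`: the least `k` such that `σ` is a product of `k` generators. -/
noncomputable def lengthB (σ : SignedPerm n) : ℕ :=
  sInf {k | ∃ l : List (SignedPerm n), (∀ s ∈ l, s ∈ generators n) ∧ l.prod = σ ∧ l.length = k}

/-- `neg(σ)`, the number of negative letters. -/
def neg (σ : SignedPerm n) : ℕ := (Finset.univ.filter fun i => σ.letter i < 0).card

/-- The strict order `-1 ≺ -2 ≺ ⋯ ≺ -n ≺ 0 ≺ 1 ≺ 2 ≺ ⋯ ≺ n`. -/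
def flagLT (a b : ℤ) : Prop := (a < 0 ∧ 0 ≤ b) ∨ (b < a ∧ a < 0) ∨ (0 ≤ a ∧ a < b)

instance (a b : ℤ) : Decidable (flagLT a b) := by unfold flagLT; infer_instance

/-- `maj(σ_1 ⋯ σ_n)` with respect to `≺`: the sum of all `p` with `1 ≤ p ≤ n - 1` and
`σ_{p+1} ≺ σ_p` (here `p = i + 1`, and `i`, `j` are the positions of `σ_p`, `σ_{p+1}`). -/
def maj (σ : SignedPerm n) : ℕ :=
  ∑ i : Fin n, if ∃ j : Fin n, (j : ℕ) = i + 1 ∧ flagLT (σ.letter j) (σ.letter i)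
    then (i : ℕ) + 1 else 0

/-- The flag major index. -/
def fmaj (σ : SignedPerm n) : ℕ := 2 * σ.maj + σ.neg

/-- The positions of the non-fixed points: those `i` with `σ_i ≠ i`. -/
def nonfixed (σ : SignedPerm n) : Finset (Fin n) :=
  Finset.univ.filter fun i => σ.letter i ≠ ((i : ℕ) + 1 : ℤ)

/-- The set `𝒟^B_n` of derangements of type `B`. -/
def derangements (n : ℕ) : Finset (SignedPerm n) :=
  Finset.univ.filter fun σ => ∀ i, σ.letter i ≠ ((i : ℕ) + 1 : ℤ)

theorem letter_eq_iff (σ : SignedPerm n) (i : Fin n) :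
    σ.letter i = ((i : ℕ) + 1 : ℤ) ↔ σ.perm i = i ∧ σ.sgn i = 1 := by
  unfold letter
  rcases Int.units_eq_one_or (σ.sgn i) with h | h
  · simp [h, Fin.ext_iff]
  · have h1 : (-1 : ℤˣ) ≠ 1 := by decide
    simp only [h, h1, and_false, iff_false, Units.val_neg, Units.val_one]
    omega

/-- The set of the absolute values of the non-fixed letters is the set of their positions. -/
theorem perm_mem_nonfixed (σ : SignedPerm n) (i : Fin n) :
    σ.perm i ∈ σ.nonfixed ↔ i ∈ σ.nonfixed := by
  simp only [nonfixed, Finset.mem_filter, Finset.mem_univ, true_and, ne_eq, letter_eq_iff,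
    not_iff_not]
  constructor
  · rintro ⟨h, h'⟩
    have := σ.perm.injective h
    rw [this] at h'
    exact ⟨this, h'⟩
  · rintro ⟨h, h'⟩
    rw [h]
    exact ⟨h, h'⟩

/-- The derangement part `dp(σ)`: the reduction of the subword of non-fixed points. Both the
positions of these letters and their absolute values (the same set, by `perm_mem_nonfixed`) are
relabelled by the increasing bijection `e` with `{0, …, k - 1}`; the signs are kept. -/
def dp (σ : SignedPerm n) : SignedPerm σ.nonfixed.card :=
  let e : Fin σ.nonfixed.card ≃ {i // i ∈ σ.nonfixed} := (σ.nonfixed.orderIsoOfFin rfl).toEquiv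
  ⟨(e.trans (σ.perm.subtypePerm σ.perm_mem_nonfixed)).trans e.symm, fun i => σ.sgn (e i)⟩

end SignedPerm

/-- The `q`-integer `[m]_q = 1 + q + ⋯ + q^{m-1}`. -/
def qInt {K : Type*} [Field K] (m : ℕ) (q : K) : K := ∑ i ∈ Finset.range m, q ^ i

/-- The `q`-factorial `[m]_q! = [1]_q [2]_q ⋯ [m]_q`. -/
def qFact {K : Type*} [Field K] (m : ℕ) (q : K) : K := ∏ i ∈ Finset.Icc 1 m, qInt i q

/-- The `q`-binomial coefficient `[m]_q! / ([k]_q! [m-k]_q!)`, for `k ≤ m`. -/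
def qBinom {K : Type*} [Field K] (m k : ℕ) (q : K) : K :=
  qFact m q / (qFact k q * qFact (m - k) q)

/-- The product `[2]_q [4]_q ⋯ [2m]_q`. -/
def evenProd {K : Type*} [Field K] (m : ℕ) (q : K) : K := ∏ i ∈ Finset.Icc 1 m, qInt (2 * i) q

/-! The sign `(-1) ^ lengthB` is a linear character: the sign of `|σ|` times the product of the
signs of the letters. Fixed points contribute nothing to either factor, so it depends only on the
derangement part; this is (ii).

For (iii), `π` is determined by its derangement part `σ` and the set of its non-fixed positions, and
`neg` also depends only on `σ`, so only `maj` varies over a fibre of `dp`. Next to a non-fixed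
letter, a fixed point compares like a zero: excedances (positive letters exceeding their position)
are larger, all other non-fixed letters smaller. Hence `maj π` is the major index of a shuffle of
the word of `σ` with zeros (`maj_eq_shuffleMaj`), and a recursion on the last entry sums `x ^ maj`
over all shuffles to `x ^ maj σ` times a Gaussian binomial (`sum_pow_shuffleMaj`).

For (i), summing (iii) over all `σ` makes the sum over `B_n` a `q²`-binomial transform of the
derangement sums (`sum_eq_sum_gaussBinom_mul`). The sum over `B_n` is a product: left multiplication
by a signed cycle raises `fmaj` by one, so each element of `B_n` is uniquely a power of the cycle
times an element of `B_{n-1}` extended by the letter `n` (`sum_signed_pow_fmaj`). Inverting the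
transform (`gaussBinom_inversion`) gives the formula. -/

namespace SignedPerm

/-! ### The sign character and the parity of the length. -/

/-- The linear character of the hyperoctahedral group with value `-1` on every Coxeter
generator. -/
def signHom (n : ℕ) : SignedPerm n →* ℤˣ where
  toFun σ := Equiv.Perm.sign σ.perm * ∏ i, σ.sgn i
  map_one' := by simp
  map_mul' σ τ := by
    simp only [mul_perm, mul_sgn, map_mul, Finset.prod_mul_distrib]
    rw [Equiv.prod_comp τ.perm σ.sgn]
    exact mul_mul_mul_comm _ _ _ _

theorem signHom_apply {n : ℕ} (σ : SignedPerm n) :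
    signHom n σ = Equiv.Perm.sign σ.perm * ∏ i, σ.sgn i := rfl

theorem signHom_of_mem_generators {n : ℕ} {s : SignedPerm n} (hs : s ∈ generators n) :
    signHom n s = -1 := by
  rcases hs with ⟨i, -, rfl⟩ | ⟨i, j, hij, rfl⟩
  · simp [signHom_apply, signChange]
  · have : i ≠ j := by
      rintro rfl
      omega
    simp [signHom_apply, transposition, Equiv.Perm.sign_swap this]

theorem mk_one_mem_closure_generators {n : ℕ} (p : Equiv.Perm (Fin n)) :
    (⟨p, fun _ => 1⟩ : SignedPerm n) ∈ Submonoid.closure (generators n) := by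
  cases n with
  | zero =>
    convert Submonoid.one_mem _
    ext i
    exact i.elim0
  | succ n =>
    let f : Equiv.Perm (Fin (n + 1)) →* SignedPerm (n + 1) :=
      { toFun := fun p => ⟨p, fun _ => 1⟩
        map_one' := rfl
        map_mul' := fun p r => by ext i <;> simp }
    have hp : p ∈ Submonoid.closure
        (Set.range fun i : Fin n => Equiv.swap i.castSucc i.succ) := by
      rw [Equiv.Perm.mclosure_swap_castSucc_succ]
      trivial
    have hle : Submonoid.closure (Set.range fun i : Fin n => Equiv.swap i.castSucc i.succ) ≤
        (Submonoid.closure (generators (n + 1))).comap f := by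
      rw [Submonoid.closure_le]
      rintro _ ⟨i, rfl⟩
      exact Submonoid.subset_closure (Or.inr ⟨i.castSucc, i.succ, by simp, rfl⟩)
    exact hle hp

/-- Every sign change is conjugate to `s₀` by a transposition. -/
theorem signChange_mem_closure_generators {n : ℕ} (i : Fin n) :
    signChange i ∈ Submonoid.closure (generators n) := by
  have h0 : 0 < n := i.pos
  have h : signChange i = (⟨Equiv.swap ⟨0, h0⟩ i, fun _ => 1⟩ : SignedPerm n) *
      signChange ⟨0, h0⟩ * ⟨Equiv.swap ⟨0, h0⟩ i, fun _ => 1⟩ := by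
    ext j
    · simp [signChange]
    · simp only [signChange, mul_sgn, one_mul, mul_one]
      congr 2
      rw [Equiv.swap_apply_eq_iff, Equiv.swap_apply_left]
  rw [h]
  exact mul_mem (mul_mem (mk_one_mem_closure_generators _)
    (Submonoid.subset_closure (Or.inl ⟨_, rfl, rfl⟩))) (mk_one_mem_closure_generators _)

theorem mk_perm_one_mem_closure_generators {n : ℕ} (s : Fin n → ℤˣ) :
    (⟨1, s⟩ : SignedPerm n) ∈ Submonoid.closure (generators n) := by
  suffices H : ∀ t : Finset (Fin n),
      (⟨1, fun i => if i ∈ t then s i else 1⟩ : SignedPerm n) ∈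
        Submonoid.closure (generators n) by
    simpa using H Finset.univ
  intro t
  induction t using Finset.induction_on with
  | empty =>
    simp only [Finset.notMem_empty, if_false]
    exact Submonoid.one_mem _
  | insert a t ha ih =>
    rcases Int.units_eq_one_or (s a) with h | h
    · convert ih using 3 with i
      by_cases hi : i = a
      · subst hi
        simp [h]
      · simp [hi]
    · convert mul_mem (signChange_mem_closure_generators a) ih using 1
      ext i
      · simp [signChange]
      · by_cases hi : i = a
        · subst hi
          simp [h, ha, signChange]
        · simp [hi, signChange]

theorem mem_closure_generators {n : ℕ} (σ : SignedPerm n) :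
    σ ∈ Submonoid.closure (generators n) := by
  have h : σ = (⟨σ.perm, fun _ => 1⟩ : SignedPerm n) * ⟨1, σ.sgn⟩ := by
    ext i <;> simp
  rw [h]
  exact mul_mem (mk_one_mem_closure_generators _) (mk_perm_one_mem_closure_generators _)

theorem neg_one_pow_lengthB {n : ℕ} (σ : SignedPerm n) : (-1) ^ σ.lengthB = signHom n σ := by
  obtain ⟨l, hl, hσ⟩ := Submonoid.exists_list_of_mem_closure (mem_closure_generators σ)
  -- Generation by the Coxeter generators makes the set nonempty, so the infimum is attained by an
  -- actual word instead of being the default value `0`.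
  have hne : {k | ∃ l : List (SignedPerm n),
      (∀ s ∈ l, s ∈ generators n) ∧ l.prod = σ ∧ l.length = k}.Nonempty :=
    ⟨_, l, hl, hσ, rfl⟩
  obtain ⟨l', hl', hσ', hlen⟩ := Nat.sInf_mem hne
  change l'.length = σ.lengthB at hlen
  rw [← hlen, ← hσ', map_list_prod, List.prod_eq_pow_card _ (-1), List.length_map]
  intro x hx
  obtain ⟨s, hs, rfl⟩ := List.mem_map.1 hx
  exact signHom_of_mem_generators (hl' s hs)

theorem neg_one_pow_lengthB_ring {R : Type*} [Ring R] {n : ℕ} (σ : SignedPerm n) :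
    (-1 : R) ^ σ.lengthB = ((signHom n σ : ℤ) : R) := by
  rw [← neg_one_pow_lengthB]
  push_cast
  rfl

end SignedPerm

/-! ### The derangement part and its inverse construction. -/

namespace SignedPerm

variable {n : ℕ}

theorem mem_nonfixed (σ : SignedPerm n) (i : Fin n) :
    i ∈ σ.nonfixed ↔ ¬(σ.perm i = i ∧ σ.sgn i = 1) := by
  simp [nonfixed, letter_eq_iff]

theorem mem_derangements (σ : SignedPerm n) :
    σ ∈ derangements n ↔ ∀ i, ¬(σ.perm i = i ∧ σ.sgn i = 1) := by
  simp [derangements, letter_eq_iff]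

/-- The increasing enumeration of the positions of the non-fixed points. -/
def nonfixedEmb (σ : SignedPerm n) : Fin σ.nonfixed.card ↪o Fin n :=
  σ.nonfixed.orderEmbOfFin rfl

theorem nonfixedEmb_mem (σ : SignedPerm n) (j : Fin σ.nonfixed.card) :
    σ.nonfixedEmb j ∈ σ.nonfixed :=
  Finset.orderEmbOfFin_mem _ _ _

theorem exists_nonfixedEmb_eq (σ : SignedPerm n) {i : Fin n} (hi : i ∈ σ.nonfixed) :
    ∃ j, σ.nonfixedEmb j = i := by
  have h : i ∈ Set.range (σ.nonfixed.orderEmbOfFin rfl) := by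
    rw [Finset.range_orderEmbOfFin]
    exact hi
  exact h

theorem nonfixedEmb_dp_perm (σ : SignedPerm n) (j : Fin σ.nonfixed.card) :
    σ.nonfixedEmb (σ.dp.perm j) = σ.perm (σ.nonfixedEmb j) := by
  unfold nonfixedEmb
  rw [← Finset.coe_orderIsoOfFin_apply]
  simp [dp]

theorem dp_sgn (σ : SignedPerm n) (j : Fin σ.nonfixed.card) :
    σ.dp.sgn j = σ.sgn (σ.nonfixedEmb j) := rfl

theorem dp_mem_derangements (σ : SignedPerm n) : σ.dp ∈ derangements σ.nonfixed.card := by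
  rw [mem_derangements]
  rintro j ⟨h1, h2⟩
  refine (mem_nonfixed σ _).1 (σ.nonfixedEmb_mem j) ⟨?_, h2⟩
  rw [← nonfixedEmb_dp_perm, h1]

theorem sgn_eq_one_of_notMem (σ : SignedPerm n) {i : Fin n} (hi : i ∉ σ.nonfixed) :
    σ.sgn i = 1 := by
  rw [mem_nonfixed, not_not] at hi
  exact hi.2

theorem perm_eq_of_notMem (σ : SignedPerm n) {i : Fin n} (hi : i ∉ σ.nonfixed) :
    σ.perm i = i := by
  rw [mem_nonfixed, not_not] at hi
  exact hi.1

theorem nonfixed_eq_map (σ : SignedPerm n) :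
    σ.nonfixed = Finset.univ.map σ.nonfixedEmb.toEmbedding := by
  ext i
  simp only [Finset.mem_map, Finset.mem_univ, true_and]
  constructor
  · exact σ.exists_nonfixedEmb_eq
  · rintro ⟨j, rfl⟩
    exact σ.nonfixedEmb_mem j

theorem prod_dp_sgn (σ : SignedPerm n) : ∏ j, σ.dp.sgn j = ∏ i, σ.sgn i := by
  rw [← Finset.prod_subset (Finset.subset_univ σ.nonfixed)
    (fun i _ hi => σ.sgn_eq_one_of_notMem hi)]
  conv_rhs => rw [nonfixed_eq_map, Finset.prod_map]
  rfl

theorem sign_dp_perm (σ : SignedPerm n) :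
    Equiv.Perm.sign σ.dp.perm = Equiv.Perm.sign σ.perm := by
  have h1 : σ.dp.perm = (σ.nonfixed.orderIsoOfFin rfl).toEquiv.symm.permCongr
      (σ.perm.subtypePerm σ.perm_mem_nonfixed) := by
    ext j
    rfl
  rw [h1, Equiv.Perm.sign_permCongr]
  convert Equiv.Perm.sign_subtypePerm (p := fun i => i ∈ σ.nonfixed) σ.perm
    σ.perm_mem_nonfixed fun i hi => ?_
  by_contra h
  exact hi (σ.perm_eq_of_notMem h)

theorem signHom_dp (σ : SignedPerm n) : signHom _ σ.dp = signHom n σ := by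
  rw [signHom_apply, signHom_apply, sign_dp_perm, prod_dp_sgn]

theorem lengthB_dp_modEq (σ : SignedPerm n) : σ.lengthB ≡ σ.dp.lengthB [MOD 2] := by
  have h : (-1 : ℤˣ) ^ σ.lengthB = (-1) ^ σ.dp.lengthB := by
    rw [neg_one_pow_lengthB, neg_one_pow_lengthB, signHom_dp]
  rcases Nat.even_or_odd σ.lengthB with h1 | h1 <;>
  rcases Nat.even_or_odd σ.dp.lengthB with h2 | h2
  · rw [Nat.ModEq, Nat.even_iff.1 h1, Nat.even_iff.1 h2]
  · rw [h1.neg_one_pow, h2.neg_one_pow] at h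
    exact absurd h (by decide)
  · rw [h1.neg_one_pow, h2.neg_one_pow] at h
    exact absurd h (by decide)
  · rw [Nat.ModEq, Nat.odd_iff.1 h1, Nat.odd_iff.1 h2]

theorem letter_neg_iff (σ : SignedPerm n) (i : Fin n) : σ.letter i < 0 ↔ σ.sgn i = -1 := by
  unfold letter
  rcases Int.units_eq_one_or (σ.sgn i) with h | h
  · have h1 : (1 : ℤˣ) ≠ -1 := by decide
    simp only [h, h1, iff_false, Units.val_one]
    omega
  · simp only [h, iff_true, Units.val_neg, Units.val_one]
    omega

theorem flagLT_letter_iff {m : ℕ} (σ : SignedPerm n) (τ : SignedPerm m) (i : Fin n) (j : Fin m) :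
    flagLT (σ.letter i) (τ.letter j) ↔ (σ.sgn i = -1 ∧ τ.sgn j = 1) ∨
      (σ.sgn i = τ.sgn j ∧ (σ.perm i : ℕ) < τ.perm j) := by
  have h1 : (1 : ℤˣ) ≠ -1 := by decide
  have h2 : (-1 : ℤˣ) ≠ 1 := by decide
  unfold letter flagLT
  rcases Int.units_eq_one_or (σ.sgn i) with h | h <;>
  rcases Int.units_eq_one_or (τ.sgn j) with h' | h' <;>
  simp only [h, h', h1, h2, Units.val_neg, Units.val_one, false_and, true_and, false_or,
    or_false, and_true, and_false, iff_true, iff_false] <;> omega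

theorem neg_eq_card (σ : SignedPerm n) :
    σ.neg = (Finset.univ.filter fun i => σ.sgn i = -1).card := by
  simp [neg, letter_neg_iff]

theorem neg_dp (σ : SignedPerm n) : σ.dp.neg = σ.neg := by
  rw [neg_eq_card, neg_eq_card]
  refine Finset.card_nbij σ.nonfixedEmb ?_ σ.nonfixedEmb.injective.injOn ?_
  · intro j hj
    simp only [Finset.coe_filter, Finset.mem_univ, true_and, Set.mem_ofPred_eq] at hj ⊢
    exact hj
  · intro i hi
    have hi' : σ.sgn i = -1 := by simpa using hi
    have hmem : i ∈ σ.nonfixed := by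
      by_contra h
      rw [σ.sgn_eq_one_of_notMem h] at hi'
      exact absurd hi' (by decide)
    obtain ⟨j, rfl⟩ := σ.exists_nonfixedEmb_eq hmem
    exact ⟨j, Finset.mem_coe.2 (Finset.mem_filter.2 ⟨Finset.mem_univ _, hi'⟩), rfl⟩

/-- The signed permutation of `[n]` acting as `σ` on the image of `e` and fixing the other
points. -/
noncomputable def inflate {k : ℕ} (e : Fin k ↪o Fin n) (σ : SignedPerm k) : SignedPerm n :=
  ⟨σ.perm.viaFintypeEmbedding e.toEmbedding, Function.extend e σ.sgn 1⟩

section inflate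

variable {k : ℕ} (e : Fin k ↪o Fin n) (σ : SignedPerm k)

theorem inflate_perm_apply (j : Fin k) : (inflate e σ).perm (e j) = e (σ.perm j) :=
  Equiv.Perm.viaFintypeEmbedding_apply_image σ.perm e.toEmbedding j

theorem inflate_sgn_apply (j : Fin k) : (inflate e σ).sgn (e j) = σ.sgn j :=
  e.injective.extend_apply _ _ _

theorem inflate_perm_of_notMem {i : Fin n} (hi : i ∉ Set.range e) :
    (inflate e σ).perm i = i :=
  Equiv.Perm.viaFintypeEmbedding_apply_notMem_range σ.perm e.toEmbedding hi

theorem inflate_sgn_of_notMem {i : Fin n} (hi : i ∉ Set.range e) :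
    (inflate e σ).sgn i = 1 :=
  Function.extend_apply' _ _ _ hi

theorem nonfixed_inflate (hσ : σ ∈ derangements k) :
    (inflate e σ).nonfixed = Finset.univ.map e.toEmbedding := by
  ext i
  rw [mem_nonfixed]
  by_cases hi : i ∈ Set.range e
  · obtain ⟨j, rfl⟩ := hi
    rw [inflate_perm_apply, inflate_sgn_apply, e.injective.eq_iff]
    simpa using (mem_derangements σ).1 hσ j
  · rw [inflate_perm_of_notMem e σ hi, inflate_sgn_of_notMem e σ hi]
    simpa using hi

theorem signHom_inflate : signHom n (inflate e σ) = signHom k σ := by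
  rw [signHom_apply, signHom_apply]
  congr 1
  · exact Equiv.Perm.viaFintypeEmbedding_sign _ _
  · rw [← Finset.prod_subset (Finset.subset_univ (Finset.univ.map e.toEmbedding)), Finset.prod_map]
    · exact Finset.prod_congr rfl fun j _ => inflate_sgn_apply e σ j
    · intro i _ hi
      exact inflate_sgn_of_notMem e σ (by simpa using hi)

end inflate

/-- The type of `π.dp` depends on `π`, so derangement parts are compared in the sigma type. The
increasing enumeration of a finite set is unique, which forces `e` to be `nonfixedEmb`. -/
theorem sigma_dp_eq_of {k : ℕ} {π : SignedPerm n} {σ : SignedPerm k} (e : Fin k ↪o Fin n)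
    (hS : π.nonfixed = Finset.univ.map e.toEmbedding)
    (hp : ∀ j, π.perm (e j) = e (σ.perm j)) (hs : ∀ j, π.sgn (e j) = σ.sgn j) :
    (⟨π.nonfixed.card, π.dp⟩ : Σ m, SignedPerm m) = ⟨k, σ⟩ := by
  have hk : k = π.nonfixed.card := by simp [hS]
  have hmem : ∀ j, e j ∈ π.nonfixed := fun j => by simp [hS]
  subst hk
  have he : e = π.nonfixedEmb := by
    refine Finset.orderEmbOfFin_unique' _ hmem
  subst he
  refine Sigma.ext rfl (heq_of_eq ?_)
  ext j
  · rw [Fin.val_inj]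
    apply π.nonfixedEmb.injective
    rw [nonfixedEmb_dp_perm, hp]
  · rw [dp_sgn, hs]

theorem sigma_dp_inflate {k : ℕ} (e : Fin k ↪o Fin n) {σ : SignedPerm k}
    (hσ : σ ∈ derangements k) :
    (⟨(inflate e σ).nonfixed.card, (inflate e σ).dp⟩ : Σ m, SignedPerm m) = ⟨k, σ⟩ :=
  sigma_dp_eq_of e (nonfixed_inflate e σ hσ) (inflate_perm_apply e σ) (inflate_sgn_apply e σ)

theorem inflate_dp (π : SignedPerm n) : inflate π.nonfixedEmb π.dp = π := by
  have hr : ∀ i, i ∉ π.nonfixed → i ∉ Set.range π.nonfixedEmb := by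
    rintro i hi ⟨j, rfl⟩
    exact hi (π.nonfixedEmb_mem j)
  ext i
  · rw [Fin.val_inj]
    by_cases hi : i ∈ π.nonfixed
    · obtain ⟨j, rfl⟩ := π.exists_nonfixedEmb_eq hi
      rw [inflate_perm_apply, nonfixedEmb_dp_perm]
    · rw [inflate_perm_of_notMem _ _ (hr i hi), π.perm_eq_of_notMem hi]
  · by_cases hi : i ∈ π.nonfixed
    · obtain ⟨j, rfl⟩ := π.exists_nonfixedEmb_eq hi
      rw [inflate_sgn_apply, dp_sgn]
    · rw [inflate_sgn_of_notMem _ _ (hr i hi), π.sgn_eq_one_of_notMem hi]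

theorem eq_of_nonfixed_eq_of_dp_eq {π ρ : SignedPerm n} (hS : π.nonfixed = ρ.nonfixed)
    (h : (⟨π.nonfixed.card, π.dp⟩ : Σ m, SignedPerm m) = ⟨ρ.nonfixed.card, ρ.dp⟩) : π = ρ := by
  have key : ∀ (S T : Finset (Fin n)) (σ : SignedPerm S.card) (τ : SignedPerm T.card), S = T →
      (⟨S.card, σ⟩ : Σ m, SignedPerm m) = ⟨T.card, τ⟩ →
      inflate (S.orderEmbOfFin rfl) σ = inflate (T.orderEmbOfFin rfl) τ := by
    rintro S _ σ τ rfl h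
    obtain rfl : σ = τ := eq_of_heq (Sigma.mk.inj_iff.1 h).2
    rfl
  rw [← inflate_dp π, ← inflate_dp ρ]
  exact key _ _ _ _ hS h

end SignedPerm

/-! ### Gaussian binomial coefficients. -/

/-- The Gaussian binomial coefficient, by the `q`-Pascal recursion. -/
def gaussBinom {R : Type*} [CommRing R] (x : R) : ℕ → ℕ → R
  | _, 0 => 1
  | 0, _ + 1 => 0
  | n + 1, k + 1 => gaussBinom x n k + x ^ (k + 1) * gaussBinom x n (k + 1)

section gaussBinom

variable {R : Type*} [CommRing R] (x : R)

@[simp] theorem gaussBinom_zero_right (n : ℕ) : gaussBinom x n 0 = 1 := by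
  cases n <;> rfl

@[simp] theorem gaussBinom_zero_succ (k : ℕ) : gaussBinom x 0 (k + 1) = 0 := rfl

theorem gaussBinom_succ_succ (n k : ℕ) : gaussBinom x (n + 1) (k + 1) =
    gaussBinom x n k + x ^ (k + 1) * gaussBinom x n (k + 1) := rfl

theorem gaussBinom_eq_zero_of_lt {n k : ℕ} (h : n < k) : gaussBinom x n k = 0 := by
  induction n generalizing k with
  | zero =>
    obtain ⟨k, rfl⟩ := Nat.exists_eq_succ_of_ne_zero h.ne'
    rfl
  | succ n ih =>
    obtain ⟨k, rfl⟩ := Nat.exists_eq_succ_of_ne_zero (by omega : k ≠ 0)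
    rw [Nat.succ_eq_add_one, gaussBinom_succ_succ, ih (by omega), ih (by omega)]
    ring

@[simp] theorem gaussBinom_self (n : ℕ) : gaussBinom x n n = 1 := by
  induction n with
  | zero => rfl
  | succ n ih => simp [gaussBinom_succ_succ, ih, gaussBinom_eq_zero_of_lt]

/-- The mirror Pascal rule. Shuffles use the defining rule or this one according to whether the
letter at hand is an excedance. Writing the upper index as `k + m` avoids subtraction. -/
theorem gaussBinom_add_succ_succ (k m : ℕ) : gaussBinom x (k + m + 1) (k + 1) =
    x ^ m * gaussBinom x (k + m) k + gaussBinom x (k + m) (k + 1) := by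
  induction k generalizing m with
  | zero =>
    induction m with
    | zero => simp
    | succ m ih =>
      simp only [gaussBinom_succ_succ, zero_add, gaussBinom_zero_right, pow_one, mul_one] at *
      linear_combination x * ih
  | succ k ihk =>
    induction m with
    | zero => simp [gaussBinom_eq_zero_of_lt]
    | succ m ihm =>
      have e1 : k + 1 + (m + 1) = k + (m + 1) + 1 := by ring
      have e2 : k + (m + 1) = k + 1 + m := by ring
      have h1 := ihk (m + 1)
      have h2 := gaussBinom_succ_succ x (k + 1 + m) k
      have h3 := gaussBinom_succ_succ x (k + 1 + m) (k + 1)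
      rw [gaussBinom_succ_succ, e1]
      rw [e2] at h1 ⊢
      linear_combination h1 + x ^ (k + 2) * ihm - x ^ (m + 1) * h2 - h3

end gaussBinom

/-! ### The major index on shuffles of a word with zeros. -/

/-- Position `p` is a descent of the word obtained by placing the letters of a word `w` at the
positions in `S` and zeros elsewhere; `E j` says that the letter `w_j` is positive, `D j` that `j`
is a descent of `w`. -/
def IsShuffleDescent (E D : ℕ → Prop) (S : Finset ℕ) (p : ℕ) : Prop :=
  (p ∈ S ∧ p + 1 ∈ S ∧ D (S.filter (· < p)).card) ∨
  (p ∈ S ∧ p + 1 ∉ S ∧ E (S.filter (· < p)).card) ∨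
  -- As `p ∉ S`, counting below `p` or below `p + 1` gives the same index, that of the letter at `p
  -- + 1`.
  (p ∉ S ∧ p + 1 ∈ S ∧ ¬E (S.filter (· < p)).card)

open Classical in
/-- The major index of the shuffle of length `n` with nonzero letters at the positions in `S`. -/
noncomputable def shuffleMaj (E D : ℕ → Prop) (n : ℕ) (S : Finset ℕ) : ℕ :=
  ∑ p ∈ Finset.range (n - 1), if IsShuffleDescent E D S p then p + 1 else 0

open Classical in
/-- The major index of the first `k` letters of a word with descents `D`. -/
noncomputable def prefixMaj (D : ℕ → Prop) (k : ℕ) : ℕ :=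
  ∑ p ∈ Finset.range (k - 1), if D p then p + 1 else 0

section shuffle

variable (E D : ℕ → Prop)

theorem isShuffleDescent_insert {S : Finset ℕ} {m p : ℕ} (h : p + 1 < m) :
    IsShuffleDescent E D (insert m S) p ↔ IsShuffleDescent E D S p := by
  have h1 : p ≠ m := by omega
  have h2 : p + 1 ≠ m := by omega
  have h3 : ((insert m S).filter (· < p)) = S.filter (· < p) := by
    rw [Finset.filter_insert, if_neg (by omega)]
  simp [IsShuffleDescent, h1, h2, h3]

theorem shuffleMaj_insert {S : Finset ℕ} {n m : ℕ} (h : n ≤ m) :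
    shuffleMaj E D n (insert m S) = shuffleMaj E D n S := by
  classical
  refine Finset.sum_congr rfl fun p hp => ?_
  rw [Finset.mem_range] at hp
  simp only [isShuffleDescent_insert E D (show p + 1 < m by omega)]

open Classical in
theorem shuffleMaj_succ_succ (n : ℕ) (S : Finset ℕ) : shuffleMaj E D (n + 2) S =
    shuffleMaj E D (n + 1) S + if IsShuffleDescent E D S n then n + 1 else 0 := by
  simp [shuffleMaj, Finset.sum_range_succ]

theorem filter_lt_of_subset_range {S : Finset ℕ} {n : ℕ} (h : S ⊆ Finset.range n) :
    S.filter (· < n) = S :=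
  Finset.filter_true_of_mem fun _ hi => Finset.mem_range.1 (h hi)

theorem filter_insert_lt {S : Finset ℕ} {n m : ℕ} (h : S ⊆ Finset.range n) (hm : n ≤ m) :
    (insert m S).filter (· < n) = S := by
  rw [Finset.filter_insert, if_neg (by omega), filter_lt_of_subset_range h]

theorem notMem_of_subset_range {S : Finset ℕ} {n m : ℕ} (h : S ⊆ Finset.range n) (hm : n ≤ m) :
    m ∉ S := fun hi => by
  have := Finset.mem_range.1 (h hi)
  omega

theorem isShuffleDescent_zero_zero {S : Finset ℕ} {n : ℕ} (h : S ⊆ Finset.range n) :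
    ¬IsShuffleDescent E D S n := by
  simp [IsShuffleDescent, notMem_of_subset_range h le_rfl,
    notMem_of_subset_range h (Nat.le_succ n)]

theorem isShuffleDescent_letter_zero {S : Finset ℕ} {n : ℕ} (h : S ⊆ Finset.range n) :
    IsShuffleDescent E D (insert n S) n ↔ E S.card := by
  simp [IsShuffleDescent, notMem_of_subset_range h (Nat.le_succ n), filter_insert_lt h le_rfl]

theorem isShuffleDescent_zero_letter {S : Finset ℕ} {n : ℕ} (h : S ⊆ Finset.range n) :
    IsShuffleDescent E D (insert (n + 1) S) n ↔ ¬E S.card := by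
  simp [IsShuffleDescent, notMem_of_subset_range h le_rfl, filter_insert_lt h (Nat.le_succ n)]

theorem isShuffleDescent_letter_letter {S : Finset ℕ} {n : ℕ} (h : S ⊆ Finset.range n) :
    IsShuffleDescent E D (insert (n + 1) (insert n S)) n ↔ D S.card := by
  have : ((insert (n + 1) (insert n S)).filter (· < n)) = S := by
    rw [Finset.filter_insert, if_neg (by omega), filter_insert_lt h le_rfl]
  simp [IsShuffleDescent, this]

variable {R : Type*} [CommRing R] (x : R)

/-- The sum of `x ^ maj` over the shuffles of `k` letters with `n + 1 - k` zeros ending with a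
zero. -/
noncomputable def zeroEndSum (n k : ℕ) : R :=
  ∑ S ∈ (Finset.range n).powersetCard k, x ^ shuffleMaj E D (n + 1) S

/-- The sum of `x ^ maj` over the shuffles of `k + 1` letters with `n - k` zeros ending with a
letter. -/
noncomputable def letterEndSum (n k : ℕ) : R :=
  ∑ S ∈ (Finset.range n).powersetCard k, x ^ shuffleMaj E D (n + 1) (insert n S)

theorem sum_powersetCard_range_succ {M : Type*} [AddCommMonoid M] (n k : ℕ) (f : Finset ℕ → M) :
    ∑ S ∈ (Finset.range (n + 1)).powersetCard (k + 1), f S =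
      ∑ S ∈ (Finset.range n).powersetCard (k + 1), f S +
        ∑ S ∈ (Finset.range n).powersetCard k, f (insert n S) := by
  rw [Finset.range_add_one, Finset.powersetCard_succ_insert (by simp), Finset.sum_union,
    Finset.sum_image]
  · intro S hS T hT h
    have hS' := notMem_of_subset_range (Finset.mem_powersetCard.1 hS).1 le_rfl
    have hT' := notMem_of_subset_range (Finset.mem_powersetCard.1 hT).1 le_rfl
    rw [← Finset.erase_insert hS', ← Finset.erase_insert hT', h]
  · rw [Finset.disjoint_left]
    intro S hS hS'
    obtain ⟨T, -, rfl⟩ := Finset.mem_image.1 hS'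
    exact notMem_of_subset_range (Finset.mem_powersetCard.1 hS).1 le_rfl
      (Finset.mem_insert_self _ _)

theorem sum_shuffle_eq (n k : ℕ) :
    ∑ S ∈ (Finset.range (n + 1)).powersetCard (k + 1), x ^ shuffleMaj E D (n + 1) S =
      zeroEndSum E D x n (k + 1) + letterEndSum E D x n k :=
  sum_powersetCard_range_succ _ _ _

open Classical in
theorem zeroEndSum_succ_succ (n k : ℕ) : zeroEndSum E D x (n + 1) (k + 1) =
    zeroEndSum E D x n (k + 1) +
      (if E k then x ^ (n + 1) else 1) * letterEndSum E D x n k := by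
  unfold zeroEndSum letterEndSum
  rw [sum_powersetCard_range_succ, Finset.mul_sum]
  congr 1
  · refine Finset.sum_congr rfl fun S hS => ?_
    rw [shuffleMaj_succ_succ,
      if_neg (isShuffleDescent_zero_zero E D (Finset.mem_powersetCard.1 hS).1), add_zero]
  · refine Finset.sum_congr rfl fun S hS => ?_
    obtain ⟨h1, h2⟩ := Finset.mem_powersetCard.1 hS
    rw [shuffleMaj_succ_succ]
    simp only [isShuffleDescent_letter_zero E D h1, h2]
    split_ifs <;> ring

open Classical in
theorem letterEndSum_succ_succ (n k : ℕ) : letterEndSum E D x (n + 1) (k + 1) =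
    (if E (k + 1) then 1 else x ^ (n + 1)) * zeroEndSum E D x n (k + 1) +
      (if D k then x ^ (n + 1) else 1) * letterEndSum E D x n k := by
  unfold zeroEndSum letterEndSum
  rw [sum_powersetCard_range_succ, Finset.mul_sum, Finset.mul_sum]
  congr 1
  · refine Finset.sum_congr rfl fun S hS => ?_
    obtain ⟨h1, h2⟩ := Finset.mem_powersetCard.1 hS
    rw [shuffleMaj_succ_succ, shuffleMaj_insert E D le_rfl]
    simp only [isShuffleDescent_zero_letter E D h1, h2]
    split_ifs <;> ring
  · refine Finset.sum_congr rfl fun S hS => ?_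
    obtain ⟨h1, h2⟩ := Finset.mem_powersetCard.1 hS
    rw [shuffleMaj_succ_succ, shuffleMaj_insert E D le_rfl]
    simp only [isShuffleDescent_letter_letter E D h1, h2]
    split_ifs <;> ring

open Classical in
theorem letterEndSum_succ_zero (n : ℕ) : letterEndSum E D x (n + 1) 0 =
    if E 0 then 1 else x ^ (n + 1) := by
  have h0 : shuffleMaj E D (n + 1) ∅ = 0 := by
    simp [shuffleMaj, IsShuffleDescent]
  have h1 := isShuffleDescent_zero_letter E D (S := ∅) (n := n) (Finset.empty_subset _)
  unfold letterEndSum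
  rw [Finset.powersetCard_zero, Finset.sum_singleton, shuffleMaj_succ_succ,
    shuffleMaj_insert E D le_rfl, h0]
  simp only [h1, Finset.card_empty]
  split_ifs <;> simp

open Classical in
theorem prefixMaj_succ_succ (k : ℕ) :
    prefixMaj D (k + 2) = prefixMaj D (k + 1) + if D k then k + 1 else 0 := by
  simp [prefixMaj, Finset.sum_range_succ]

-- Separating by the last entry closes the recursion. The hypotheses say that a zero always fits
-- between consecutive letters of different kinds: positive then negative is a descent, negative
-- then positive is not. In every consistent case the recursion is then one of the two Pascal rules.
open Classical in
theorem endSums_eq {K : ℕ} (hED : ∀ j, j + 1 < K → E j → ¬E (j + 1) → D j)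
    (hDE : ∀ j, j + 1 < K → ¬E j → E (j + 1) → ¬D j) (n k : ℕ) (hk : k < K) :
    zeroEndSum E D x n (k + 1) =
      x ^ prefixMaj D (k + 1) * (if E k then x ^ (k + 1) else 1) * gaussBinom x n (k + 1) ∧
    letterEndSum E D x n k =
      x ^ prefixMaj D (k + 1) * (if E k then 1 else x ^ (n - k)) * gaussBinom x n k := by
  induction n generalizing k with
  | zero =>
    constructor
    · simp [zeroEndSum, Finset.powersetCard_eq_empty.2 (Finset.card_empty.trans_lt k.succ_pos)]
    · cases k with
      | zero => simp [letterEndSum, shuffleMaj, prefixMaj]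
      | succ k => simp [letterEndSum, Finset.powersetCard_eq_empty.2 (Finset.card_empty.trans_lt k.succ_pos)]
  | succ n ih =>
    -- For `k > n` the exponent `n - k` is truncated, but the binomials vanish.
    have pascal : ∀ k, k ≤ n ∨ gaussBinom x n k = 0 ∧ gaussBinom x n (k + 1) = 0 := fun k =>
      (le_or_gt k n).imp_right fun h =>
        ⟨gaussBinom_eq_zero_of_lt x h, gaussBinom_eq_zero_of_lt x (by omega)⟩
    constructor
    · rw [zeroEndSum_succ_succ, (ih k hk).1, (ih k hk).2]
      rcases pascal k with h | ⟨h, h'⟩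
      · obtain ⟨m, rfl⟩ := Nat.exists_eq_add_of_le h
        rw [gaussBinom_add_succ_succ, Nat.add_sub_cancel_left]
        split_ifs <;> ring
      · rw [gaussBinom_succ_succ, h, h']
        ring
    · cases k with
      | zero =>
        rw [letterEndSum_succ_zero]
        simp [prefixMaj]
      | succ k =>
        obtain ⟨h1, h2⟩ := ih k (by omega)
        rw [letterEndSum_succ_succ, h1, h2, prefixMaj_succ_succ, Nat.add_sub_add_right]
        rcases pascal k with h | ⟨h, h'⟩
        · obtain ⟨m, rfl⟩ := Nat.exists_eq_add_of_le h
          rw [Nat.add_sub_cancel_left]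
          have h3 := hED k hk
          have h4 := hDE k hk
          by_cases hE' : E (k + 1) <;> by_cases hE : E k <;> by_cases hD : D k <;>
            simp only [hE, hE', hD, if_true, if_false, not_true_eq_false, not_false_eq_true,
              forall_true_left, imp_false] at h3 h4 ⊢ <;>
            first
            | rw [gaussBinom_succ_succ]; ring1
            | rw [gaussBinom_add_succ_succ]; ring1
        · rw [gaussBinom_succ_succ, h, h']
          ring

theorem sum_pow_shuffleMaj {K : ℕ} (hED : ∀ j, j + 1 < K → E j → ¬E (j + 1) → D j)
    (hDE : ∀ j, j + 1 < K → ¬E j → E (j + 1) → ¬D j) (n : ℕ) :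
    ∑ S ∈ (Finset.range n).powersetCard K, x ^ shuffleMaj E D n S =
      x ^ prefixMaj D K * gaussBinom x n K := by
  classical
  cases K with
  | zero => simp [shuffleMaj, IsShuffleDescent, prefixMaj]
  | succ k =>
    cases n with
    | zero => simp [Finset.powersetCard_eq_empty.2 (Finset.card_empty.trans_lt k.succ_pos)]
    | succ n =>
      obtain ⟨h1, h2⟩ := endSums_eq E D x hED hDE n k k.lt_succ_self
      rw [sum_shuffle_eq, h1, h2]
      rcases le_or_gt k n with h | h
      · obtain ⟨m, rfl⟩ := Nat.exists_eq_add_of_le h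
        rw [Nat.add_sub_cancel_left]
        by_cases hE : E k <;> simp only [hE, if_true, if_false]
        · rw [gaussBinom_succ_succ]
          ring
        · rw [gaussBinom_add_succ_succ]
          ring
      · rw [gaussBinom_succ_succ, gaussBinom_eq_zero_of_lt x h,
          gaussBinom_eq_zero_of_lt x (show n < k + 1 by omega)]
        ring

end shuffle

/-! ### Fixed points behave as zeros. -/

namespace SignedPerm

variable {n : ℕ}

/-- The `j`-th letter (counted from `0`) is positive and exceeds its position. -/
def IsExcedance (σ : SignedPerm n) (j : ℕ) : Prop :=
  ∃ i : Fin n, (i : ℕ) = j ∧ σ.sgn i = 1 ∧ i < σ.perm i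

/-- The `j`-th letter (counted from `0`) is followed by a smaller one. -/
def IsDescent (σ : SignedPerm n) (j : ℕ) : Prop :=
  ∃ a b : Fin n, (a : ℕ) = j ∧ (b : ℕ) = j + 1 ∧ flagLT (σ.letter b) (σ.letter a)

theorem isExcedance_iff (σ : SignedPerm n) (i : Fin n) :
    σ.IsExcedance i ↔ σ.sgn i = 1 ∧ i < σ.perm i := by
  constructor
  · rintro ⟨a, ha, h⟩
    rwa [Fin.ext ha] at h
  · exact fun h => ⟨i, rfl, h⟩

theorem isDescent_iff (σ : SignedPerm n) {a b : Fin n} (hab : (b : ℕ) = a + 1) :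
    σ.IsDescent a ↔ (σ.sgn b = -1 ∧ σ.sgn a = 1) ∨ (σ.sgn b = σ.sgn a ∧ σ.perm b < σ.perm a) := by
  have h0 := flagLT_letter_iff σ σ b a
  rw [Fin.val_fin_lt] at h0
  rw [← h0]
  constructor
  · rintro ⟨a', b', ha, hb, h⟩
    obtain rfl : a' = a := Fin.ext ha
    obtain rfl : b' = b := Fin.ext (hb.trans hab.symm)
    exact h
  · exact fun h => ⟨a, b, rfl, hab, h⟩

theorem maj_eq_prefixMaj (σ : SignedPerm n) : σ.maj = prefixMaj σ.IsDescent n := by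
  classical
  have h1 : σ.maj = ∑ p ∈ Finset.range n, if σ.IsDescent p then p + 1 else 0 := by
    rw [Finset.sum_range]
    refine Finset.sum_congr rfl fun i _ => ?_
    refine if_congr ⟨?_, ?_⟩ rfl rfl
    · rintro ⟨j, hj, h⟩
      exact ⟨i, j, rfl, hj, h⟩
    · rintro ⟨a, b, ha, hb, h⟩
      obtain rfl : a = i := Fin.ext ha
      exact ⟨b, hb, h⟩
  rw [h1, prefixMaj]
  symm
  refine Finset.sum_subset (Finset.range_mono (Nat.sub_le n 1)) fun p hp hp' => if_neg ?_
  rintro ⟨a, b, -, hb, -⟩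
  rw [Finset.mem_range] at hp hp'
  omega

/-- The positions of the non-fixed points, as natural numbers. -/
def nonfixedNat (σ : SignedPerm n) : Finset ℕ := σ.nonfixed.map Fin.valEmbedding

theorem val_mem_nonfixedNat (σ : SignedPerm n) (i : Fin n) :
    (i : ℕ) ∈ σ.nonfixedNat ↔ i ∈ σ.nonfixed :=
  Finset.mem_map' Fin.valEmbedding

theorem nonfixedNat_eq_map (σ : SignedPerm n) : σ.nonfixedNat =
    Finset.univ.map (σ.nonfixedEmb.toEmbedding.trans Fin.valEmbedding) :=
  (congrArg (Finset.map Fin.valEmbedding) σ.nonfixed_eq_map).trans (Finset.map_map _ _ _)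

theorem card_nonfixedNat_lt (σ : SignedPerm n) (j : Fin σ.nonfixed.card) :
    (σ.nonfixedNat.filter (· < (σ.nonfixedEmb j : ℕ))).card = j := by
  rw [nonfixedNat_eq_map, Finset.filter_map, Finset.card_map,
    ← Fin.card_Iio j]
  congr 1
  ext i
  simp

theorem card_filter_lt_succ (S : Finset ℕ) (p : ℕ) :
    (S.filter (· < p + 1)).card = (S.filter (· < p)).card + if p ∈ S then 1 else 0 := by
  split_ifs with h
  · rw [← Finset.card_insert_of_notMem (a := p) (by simp)]
    congr 1
    ext i
    simp only [Finset.mem_filter, Finset.mem_insert]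
    constructor
    · rintro ⟨h1, h2⟩
      rcases Nat.lt_succ_iff_lt_or_eq.1 h2 with h3 | h3
      · exact Or.inr ⟨h1, h3⟩
      · exact Or.inl h3
    · rintro (rfl | ⟨h1, h2⟩)
      · exact ⟨h, Nat.lt_succ_self _⟩
      · exact ⟨h1, h2.trans (Nat.lt_succ_self _)⟩
  · rw [add_zero]
    congr 1
    ext i
    simp only [Finset.mem_filter]
    refine and_congr_right fun h1 => ?_
    have : i ≠ p := by
      rintro rfl
      exact h h1
    omega

/-- Positions and absolute values are relabelled by the same increasing map, so comparing a letter
with its position is unaffected. -/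
theorem isExcedance_dp_iff (σ : SignedPerm n) (j : Fin σ.nonfixed.card) :
    σ.dp.IsExcedance j ↔ σ.IsExcedance (σ.nonfixedEmb j) := by
  rw [isExcedance_iff, isExcedance_iff, dp_sgn, ← nonfixedEmb_dp_perm, OrderEmbedding.lt_iff_lt]

/-- A positive non-fixed letter beside a fixed point equals neither its own position nor the
neighbouring fixed value, so exceeding one of these two consecutive numbers is the same as exceeding
the other. -/
theorem isDescent_iff_isShuffleDescent (σ : SignedPerm n) {p : ℕ} (hp : p + 1 < n) :
    σ.IsDescent p ↔ IsShuffleDescent σ.dp.IsExcedance σ.dp.IsDescent σ.nonfixedNat p := by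
  obtain ⟨a, rfl⟩ : ∃ a : Fin n, (a : ℕ) = p := ⟨⟨p, by omega⟩, rfl⟩
  obtain ⟨b, hb⟩ : ∃ b : Fin n, (b : ℕ) = a + 1 := ⟨⟨a + 1, hp⟩, rfl⟩
  have hcard := card_filter_lt_succ σ.nonfixedNat a
  have h1 : (-1 : ℤˣ) ≠ 1 := by decide
  have hinj : ∀ i j, σ.perm i = j → σ.perm j = j → i = j := fun i j hi hj =>
    σ.perm.injective (hi.trans hj.symm)
  have hne : a ≠ b := fun h => by
    rw [h] at hb
    omega
  rw [isDescent_iff σ hb, IsShuffleDescent, ← hb, val_mem_nonfixedNat, val_mem_nonfixedNat]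
  simp only [← hb, val_mem_nonfixedNat] at hcard
  by_cases ha : a ∈ σ.nonfixed <;> by_cases hb' : b ∈ σ.nonfixed <;>
    simp only [ha, hb', true_and, false_and, and_false, or_false, false_or, not_true_eq_false,
      not_false_eq_true, if_true, if_false] at hcard ⊢
  · obtain ⟨i, rfl⟩ := σ.exists_nonfixedEmb_eq ha
    obtain ⟨j, rfl⟩ := σ.exists_nonfixedEmb_eq hb'
    rw [card_nonfixedNat_lt, card_nonfixedNat_lt] at hcard
    rw [card_nonfixedNat_lt, isDescent_iff σ.dp hcard, dp_sgn, dp_sgn, ← nonfixedEmb_dp_perm,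
      ← nonfixedEmb_dp_perm, OrderEmbedding.lt_iff_lt]
  · obtain ⟨i, rfl⟩ := σ.exists_nonfixedEmb_eq ha
    rw [card_nonfixedNat_lt, isExcedance_dp_iff, isExcedance_iff, σ.sgn_eq_one_of_notMem hb',
      σ.perm_eq_of_notMem hb']
    have h2 := hinj (σ.nonfixedEmb i) b
    have h3 := σ.perm_eq_of_notMem hb'
    rcases Int.units_eq_one_or (σ.sgn (σ.nonfixedEmb i)) with h | h <;>
      simp only [h, h1, h1.symm, true_and, false_and, false_or, or_false]
    have h4 : σ.perm (σ.nonfixedEmb i) ≠ b := fun h5 => hne (h2 h5 h3)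
    rw [Fin.lt_def, Fin.lt_def]
    rw [ne_eq, Fin.ext_iff] at h4
    omega
  · obtain ⟨j, rfl⟩ := σ.exists_nonfixedEmb_eq hb'
    rw [add_zero, card_nonfixedNat_lt] at hcard
    rw [← hcard, isExcedance_dp_iff, isExcedance_iff, σ.sgn_eq_one_of_notMem ha,
      σ.perm_eq_of_notMem ha]
    have h3 := σ.perm_eq_of_notMem ha
    have h2 : σ.perm (σ.nonfixedEmb j) ≠ a := fun h5 => hne (hinj _ _ h5 h3).symm
    have h4 := (mem_nonfixed σ _).1 hb'
    rcases Int.units_eq_one_or (σ.sgn (σ.nonfixedEmb j)) with h | h <;>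
      simp only [h, h1, h1.symm, true_and, and_true, false_and, false_or, or_false,
        not_false_eq_true] at h4 ⊢
    rw [Fin.lt_def, Fin.lt_def]
    rw [ne_eq, Fin.ext_iff] at h2
    rw [Fin.ext_iff] at h4
    omega
  · rw [σ.sgn_eq_one_of_notMem ha, σ.sgn_eq_one_of_notMem hb', σ.perm_eq_of_notMem ha,
      σ.perm_eq_of_notMem hb']
    simp only [h1.symm, false_and, true_and, false_or, iff_false, Fin.lt_def]
    omega

theorem maj_eq_shuffleMaj (σ : SignedPerm n) :
    σ.maj = shuffleMaj σ.dp.IsExcedance σ.dp.IsDescent n σ.nonfixedNat := by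
  classical
  rw [maj_eq_prefixMaj]
  refine Finset.sum_congr rfl fun p hp => ?_
  rw [Finset.mem_range] at hp
  simp only [isDescent_iff_isShuffleDescent σ (show p + 1 < n by omega)]

/-- A non-excedance of a derangement is negative or strictly below its position, while an excedance
at `j` is already at least `j + 1`. -/
theorem isDescent_of_isExcedance {σ : SignedPerm n} (hσ : σ ∈ derangements n) {j : ℕ}
    (hj : j + 1 < n) (h : σ.IsExcedance j) (h' : ¬σ.IsExcedance (j + 1)) : σ.IsDescent j := by
  obtain ⟨a, rfl⟩ : ∃ a : Fin n, (a : ℕ) = j := ⟨⟨j, by omega⟩, rfl⟩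
  obtain ⟨b, hb⟩ : ∃ b : Fin n, (b : ℕ) = a + 1 := ⟨⟨a + 1, hj⟩, rfl⟩
  rw [← hb, isExcedance_iff] at h'
  rw [isExcedance_iff] at h
  rw [isDescent_iff σ hb, h.1]
  have h2 := (mem_derangements σ).1 hσ b
  rcases Int.units_eq_one_or (σ.sgn b) with h3 | h3
  · rw [Fin.lt_def] at *
    rw [Fin.ext_iff] at h2
    simp only [h3, true_and, and_true] at *
    right
    omega
  · exact Or.inl ⟨h3, rfl⟩

theorem not_isDescent_of_not_isExcedance {σ : SignedPerm n} (hσ : σ ∈ derangements n) {j : ℕ}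
    (hj : j + 1 < n) (h : ¬σ.IsExcedance j) (h' : σ.IsExcedance (j + 1)) : ¬σ.IsDescent j := by
  obtain ⟨a, rfl⟩ : ∃ a : Fin n, (a : ℕ) = j := ⟨⟨j, by omega⟩, rfl⟩
  obtain ⟨b, hb⟩ : ∃ b : Fin n, (b : ℕ) = a + 1 := ⟨⟨a + 1, hj⟩, rfl⟩
  rw [← hb, isExcedance_iff] at h'
  rw [isExcedance_iff] at h
  rw [isDescent_iff σ hb, h'.1]
  have h2 := (mem_derangements σ).1 hσ a
  have h1 : (1 : ℤˣ) ≠ -1 := by decide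
  rintro (⟨h3, -⟩ | ⟨h3, h4⟩)
  · exact h1 h3
  · rw [Fin.lt_def] at *
    rw [Fin.ext_iff] at h2
    simp only [← h3, true_and, and_true] at *
    omega

/-- The sum of `x ^ maj` over the signed permutations with a given derangement part. -/
theorem sum_pow_maj_of_dp_eq {R : Type*} [CommRing R] (x : R) {k : ℕ} {σ : SignedPerm k}
    (hσ : σ ∈ derangements k) :
    ∑ π : SignedPerm n with (⟨π.nonfixed.card, π.dp⟩ : Σ m, SignedPerm m) = ⟨k, σ⟩,
      x ^ π.maj = x ^ σ.maj * gaussBinom x n k := by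
  rw [maj_eq_prefixMaj σ, ← sum_pow_shuffleMaj σ.IsExcedance σ.IsDescent x
    (fun j hj => isDescent_of_isExcedance hσ hj)
    (fun j hj => not_isDescent_of_not_isExcedance hσ hj)]
  -- The fibre of `dp` over `σ` is in bijection with the `k`-subsets of positions; `inflate`
  -- provides surjectivity.
  refine Finset.sum_nbij nonfixedNat ?_ ?_ ?_ ?_
  · intro π hπ
    have h := congrArg Sigma.fst (Finset.mem_filter.1 hπ).2
    rw [Finset.mem_powersetCard]
    refine ⟨fun p hp => ?_, (Finset.card_map _).trans h⟩
    obtain ⟨i, -, rfl⟩ := Finset.mem_map.1 hp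
    exact Finset.mem_range.2 i.2
  · intro π hπ ρ hρ h
    refine eq_of_nonfixed_eq_of_dp_eq (Finset.map_injective _ h) ?_
    exact (Finset.mem_filter.1 hπ).2.trans (Finset.mem_filter.1 hρ).2.symm
  · intro S hS
    obtain ⟨h1, h2⟩ := Finset.mem_powersetCard.1 hS
    let T : Finset (Fin n) := Finset.univ.filter fun i => (i : ℕ) ∈ S
    have hT : T.map Fin.valEmbedding = S := by
      ext p
      simp only [T, Finset.mem_map, Finset.mem_filter, Finset.mem_univ, true_and,
        Fin.valEmbedding_apply]
      constructor
      · rintro ⟨i, hi, rfl⟩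
        exact hi
      · exact fun hp => ⟨⟨p, Finset.mem_range.1 (h1 hp)⟩, hp, rfl⟩
    have hTk : T.card = k := by rw [← h2, ← hT, Finset.card_map]
    refine ⟨inflate (T.orderEmbOfFin hTk) σ, ?_, ?_⟩
    · exact Finset.mem_coe.2 (Finset.mem_filter.2 ⟨Finset.mem_univ _, sigma_dp_inflate _ hσ⟩)
    · rw [nonfixedNat, nonfixed_inflate _ _ hσ, ← hT]
      congr 1
      rw [← Finset.coe_inj]
      simp
  · intro π hπ
    obtain ⟨h1, h2⟩ := Sigma.mk.inj_iff.1 (Finset.mem_filter.1 hπ).2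
    subst h1
    obtain rfl := eq_of_heq h2
    rw [maj_eq_shuffleMaj]

theorem sum_signed_pow_fmaj_of_dp_eq {R : Type*} [CommRing R] (q : R) {k : ℕ}
    {σ : SignedPerm k} (hσ : σ ∈ derangements k) :
    ∑ π : SignedPerm n with (⟨π.nonfixed.card, π.dp⟩ : Σ m, SignedPerm m) = ⟨k, σ⟩,
      (-1) ^ π.lengthB * q ^ π.fmaj =
        (-1) ^ σ.lengthB * q ^ σ.fmaj * gaussBinom (q ^ 2) n k := by
  have h := congrArg (fun r => (-1) ^ σ.lengthB * q ^ σ.neg * r)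
    (sum_pow_maj_of_dp_eq (n := n) (q ^ 2) hσ)
  simp only [Finset.mul_sum] at h
  rw [fmaj, pow_add, pow_mul]
  refine Eq.trans (Finset.sum_congr rfl fun π hπ => ?_) (h.trans (by ring))
  obtain ⟨h1, h2⟩ := Sigma.mk.inj_iff.1 (Finset.mem_filter.1 hπ).2
  subst h1
  obtain rfl := eq_of_heq h2
  rw [fmaj, pow_add, pow_mul, neg_dp, neg_one_pow_lengthB_ring, neg_one_pow_lengthB_ring,
    signHom_dp]
  ring

end SignedPerm

/-! ### The signed cycle and the generating function of the whole group. -/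

namespace SignedPerm

variable {m : ℕ}

/-- The signed cycle `n ↦ n - 1 ↦ ⋯ ↦ 1 ↦ -n`, for `n = m + 1`. -/
def signedCycle (m : ℕ) : SignedPerm (m + 1) :=
  ⟨(finRotate (m + 1))⁻¹, fun i => if i = 0 then -1 else 1⟩

theorem signHom_signedCycle (m : ℕ) : signHom (m + 1) (signedCycle m) = (-1) ^ (m + 1) := by
  simp [signHom_apply, signedCycle, pow_succ]

theorem val_signedCycle_mul_perm (π : SignedPerm (m + 1)) (i : Fin (m + 1)) :
    ((signedCycle m * π).perm i : ℕ) = if π.perm i = 0 then m else (π.perm i : ℕ) - 1 := by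
  have h : (signedCycle m * π).perm i = (finRotate (m + 1)).symm (π.perm i) := rfl
  rw [h]
  generalize π.perm i = v
  cases v using Fin.cases with
  | zero =>
    rw [(finRotate (m + 1)).symm_apply_eq.2 finRotate_last.symm]
    simp
  | succ v =>
    have h2 : (finRotate (m + 1)).symm v.succ = v.castSucc := by
      rw [Equiv.symm_apply_eq]
      exact (finRotate_of_lt v.2).symm
    rw [h2]
    simp

theorem signedCycle_mul_sgn (π : SignedPerm (m + 1)) (i : Fin (m + 1)) :
    (signedCycle m * π).sgn i = if π.perm i = 0 then -π.sgn i else π.sgn i := by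
  rw [mul_sgn]
  simp only [signedCycle]
  split_ifs <;> simp

/-- The number of steps of the signed cycle from `n` to the last letter, for `n = m + 1`. -/
def level (π : SignedPerm (m + 1)) : ℕ :=
  m - π.perm (Fin.last m) + if π.sgn (Fin.last m) = -1 then m + 1 else 0

theorem level_signedCycle_mul (π : SignedPerm (m + 1))
    (h : ¬(π.perm (Fin.last m) = 0 ∧ π.sgn (Fin.last m) = -1)) :
    (signedCycle m * π).level = π.level + 1 := by
  have h1 : (1 : ℤˣ) ≠ -1 := by decide
  have h2 := (π.perm (Fin.last m)).2
  unfold level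
  rw [val_signedCycle_mul_perm, signedCycle_mul_sgn]
  by_cases h0 : π.perm (Fin.last m) = 0
  · rcases Int.units_eq_one_or (π.sgn (Fin.last m)) with hs | hs
    · simp [h0, hs, h1]
    · exact absurd ⟨h0, hs⟩ h
  · have h3 : (π.perm (Fin.last m) : ℕ) ≠ 0 := fun h' => h0 (Fin.ext h')
    simp only [h0, if_false]
    omega

theorem not_last_letter_eq_neg_one (π : SignedPerm (m + 1)) (h : π.level + 1 < 2 * (m + 1)) :
    ¬(π.perm (Fin.last m) = 0 ∧ π.sgn (Fin.last m) = -1) := by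
  rintro ⟨h0, hs⟩
  simp only [level, h0, hs, if_true, Fin.val_zero] at h
  omega

theorem neg_eq_sum {n : ℕ} (σ : SignedPerm n) : σ.neg = ∑ i, if σ.sgn i = -1 then 1 else 0 := by
  rw [neg_eq_card, Finset.card_filter]

theorem neg_signedCycle_mul (π : SignedPerm (m + 1)) {p : Fin (m + 1)} (hp : π.perm p = 0) :
    (signedCycle m * π).neg + (if π.sgn p = -1 then 1 else 0) =
      π.neg + if π.sgn p = 1 then 1 else 0 := by
  have h1 : (1 : ℤˣ) ≠ -1 := by decide
  have h2 : (-1 : ℤˣ) ≠ 1 := by decide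
  have hne : ∀ i ∈ Finset.univ.erase p, π.perm i ≠ 0 := fun i hi h =>
    (Finset.mem_erase.1 hi).1 (π.perm.injective (h.trans hp.symm))
  rw [neg_eq_sum, neg_eq_sum, ← Finset.add_sum_erase _ _ (Finset.mem_univ p),
    ← Finset.add_sum_erase _ _ (Finset.mem_univ p), signedCycle_mul_sgn, if_pos hp,
    Finset.sum_congr rfl fun i hi => by rw [signedCycle_mul_sgn, if_neg (hne i hi)]]
  rcases Int.units_eq_one_or (π.sgn p) with hs | hs
  · simp only [hs, h1, if_true, if_false]
    omega
  · simp only [hs, h1, h2, neg_neg, if_true, if_false]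
    omega

/-- The cycle moves each letter one step down in `≺` (with `1` going to `-n`); only `-1` wraps
around, and it does not occur here, so relative order is preserved. -/
theorem isDescent_signedCycle_mul_of_pos (π : SignedPerm (m + 1)) {p : Fin (m + 1)}
    (hp : π.perm p = 0) (hs : π.sgn p = 1) {j : ℕ} (hj : j < m) :
    (signedCycle m * π).IsDescent j ↔ π.IsDescent j := by
  obtain ⟨a, rfl⟩ : ∃ a : Fin (m + 1), (a : ℕ) = j := ⟨⟨j, by omega⟩, rfl⟩
  obtain ⟨b, hb⟩ : ∃ b : Fin (m + 1), (b : ℕ) = a + 1 := ⟨⟨a + 1, by omega⟩, rfl⟩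
  have h1 : (1 : ℤˣ) ≠ -1 := by decide
  have h2 : (-1 : ℤˣ) ≠ 1 := by decide
  have hz : ∀ i, π.perm i = 0 ↔ i = p := fun i =>
    ⟨fun hi => π.perm.injective (hi.trans hp.symm), fun hi => hi ▸ hp⟩
  have hpos : ∀ i, i ≠ p → (π.perm i : ℕ) ≠ 0 := fun i hi h => hi ((hz i).1 (Fin.ext h))
  have hp0 : (π.perm p : ℕ) = 0 := by rw [hp]; rfl
  have hne : a ≠ b := fun h => by
    rw [h] at hb
    omega
  have hne' : (π.perm a : ℕ) ≠ π.perm b := fun h => hne (π.perm.injective (Fin.ext h))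
  have ha := (π.perm a).2
  have hb' := (π.perm b).2
  rw [isDescent_iff _ hb, isDescent_iff _ hb, Fin.lt_def, Fin.lt_def, val_signedCycle_mul_perm,
    val_signedCycle_mul_perm, signedCycle_mul_sgn, signedCycle_mul_sgn]
  simp only [hz]
  by_cases hap : a = p
  · have hbp : b ≠ p := fun h => hne (hap.trans h.symm)
    have hb0 := hpos b hbp
    subst hap
    rcases Int.units_eq_one_or (π.sgn b) with hsb | hsb
    · simp [hp0, hbp, hs, hsb, h1, h2]
    · simp [hp0, hbp, hs, hsb, h2]
      omega
  · have ha0 := hpos a hap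
    by_cases hbp : b = p
    · subst hbp
      rcases Int.units_eq_one_or (π.sgn a) with hsa | hsa
      · simp [hp0, hap, hs, hsa, h1, h2]
        omega
      · simp [hp0, hap, hs, hsa, h1, h2]
    · have hb0 := hpos b hbp
      have h3 : (π.perm b : ℕ) - 1 < (π.perm a : ℕ) - 1 ↔ (π.perm b : ℕ) < π.perm a := by omega
      simp [hap, hbp, h3]

/-- Here the least letter `-1`, at `p`, becomes the greatest letter `n`: the descent into `p`
disappears and a descent out of `p` appears. -/
theorem isDescent_signedCycle_mul_of_neg (π : SignedPerm (m + 1)) {p : Fin (m + 1)}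
    (hp : π.perm p = 0) (hs : π.sgn p = -1) {j : ℕ} (hj : j < m) :
    ((signedCycle m * π).IsDescent j ↔ (π.IsDescent j ∧ j + 1 ≠ p) ∨ j = p) ∧
      (j + 1 = p → π.IsDescent j) ∧ (j = p → ¬π.IsDescent j) := by
  obtain ⟨a, rfl⟩ : ∃ a : Fin (m + 1), (a : ℕ) = j := ⟨⟨j, by omega⟩, rfl⟩
  obtain ⟨b, hb⟩ : ∃ b : Fin (m + 1), (b : ℕ) = a + 1 := ⟨⟨a + 1, by omega⟩, rfl⟩
  have h1 : (1 : ℤˣ) ≠ -1 := by decide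
  have h2 : (-1 : ℤˣ) ≠ 1 := by decide
  have hz : ∀ i, π.perm i = 0 ↔ i = p := fun i =>
    ⟨fun hi => π.perm.injective (hi.trans hp.symm), fun hi => hi ▸ hp⟩
  have hpos : ∀ i, i ≠ p → (π.perm i : ℕ) ≠ 0 := fun i hi h => hi ((hz i).1 (Fin.ext h))
  have hp0 : (π.perm p : ℕ) = 0 := by rw [hp]; rfl
  have hne : a ≠ b := fun h => by
    rw [h] at hb
    omega
  have hne' : (π.perm a : ℕ) ≠ π.perm b := fun h => hne (π.perm.injective (Fin.ext h))
  have ha := (π.perm a).2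
  have hb' := (π.perm b).2
  rw [isDescent_iff _ hb, isDescent_iff _ hb, Fin.lt_def, Fin.lt_def, val_signedCycle_mul_perm,
    val_signedCycle_mul_perm, signedCycle_mul_sgn, signedCycle_mul_sgn]
  simp only [hz, ← hb, Fin.val_inj, ne_eq]
  by_cases hap : a = p
  · have hbp : b ≠ p := fun h => hne (hap.trans h.symm)
    have hb0 := hpos b hbp
    subst hap
    rcases Int.units_eq_one_or (π.sgn b) with hsb | hsb
    · simp [hp0, hbp, hs, hsb, h1, h2]
      omega
    · simp [hp0, hbp, hs, hsb, h2]
  · have ha0 := hpos a hap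
    by_cases hbp : b = p
    · subst hbp
      rcases Int.units_eq_one_or (π.sgn a) with hsa | hsa
      · simp [hp0, hap, hs, hsa, h1, h2]
      · simp [hp0, hap, hs, hsa, h1, h2]
        omega
    · have hb0 := hpos b hbp
      have h3 : (π.perm b : ℕ) - 1 < (π.perm a : ℕ) - 1 ↔ (π.perm b : ℕ) < π.perm a := by omega
      simp [hap, hbp, h3]

theorem maj_signedCycle_mul_of_pos (π : SignedPerm (m + 1)) {p : Fin (m + 1)}
    (hp : π.perm p = 0) (hs : π.sgn p = 1) : (signedCycle m * π).maj = π.maj := by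
  classical
  rw [maj_eq_prefixMaj, maj_eq_prefixMaj]
  refine Finset.sum_congr rfl fun j hj => ?_
  simp only [isDescent_signedCycle_mul_of_pos π hp hs (Finset.mem_range.1 hj)]

theorem maj_signedCycle_mul_of_neg (π : SignedPerm (m + 1)) {p : Fin (m + 1)}
    (hp : π.perm p = 0) (hs : π.sgn p = -1) (hpm : (p : ℕ) < m) :
    (signedCycle m * π).maj = π.maj + 1 := by
  classical
  -- The lost descent weighs `p` and the gained one `p + 1`; both are kept as summands to avoid
  -- subtraction. For `p = 0` nothing is lost, in agreement with the weight `0`.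
  have h : ∀ j ∈ Finset.range m,
      (if (signedCycle m * π).IsDescent j then j + 1 else 0) + (if j + 1 = p then j + 1 else 0) =
        (if π.IsDescent j then j + 1 else 0) + if j = p then j + 1 else 0 := by
    intro j hj
    obtain ⟨h1, h2, h3⟩ := isDescent_signedCycle_mul_of_neg π hp hs (Finset.mem_range.1 hj)
    simp only [h1]
    by_cases h4 : j + 1 = p
    · have h5 : j ≠ p := by omega
      simp [h4, h5, h2 h4]
    · by_cases h5 : j = p
      · simp [h4, if_pos h5, h3 h5]
      · simp [h4, h5]
  have hsum := Finset.sum_congr rfl h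
  rw [Finset.sum_add_distrib, Finset.sum_add_distrib] at hsum
  have h1 : ∑ j ∈ Finset.range m, (if j = p then j + 1 else 0) = (p : ℕ) + 1 := by
    rw [Finset.sum_ite_eq', if_pos (Finset.mem_range.2 hpm)]
  have h2 : ∑ j ∈ Finset.range m, (if j + 1 = p then j + 1 else 0) = (p : ℕ) := by
    rcases Nat.eq_zero_or_eq_succ_pred (p : ℕ) with h0 | h0
    · rw [h0]
      simp
    · rw [h0]
      simp only [Nat.succ_eq_add_one, add_left_inj]
      rw [Finset.sum_ite_eq', if_pos (Finset.mem_range.2 (by omega))]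
  rw [h1, h2] at hsum
  rw [maj_eq_prefixMaj, maj_eq_prefixMaj, prefixMaj, prefixMaj, Nat.add_sub_cancel]
  omega

/-- If `1` occurs, `neg` rises by one and `maj` is unchanged. If `-1` occurs, `neg` drops by one and
`maj` rises by one, a net change of `2 - 1`; this needs a position after `-1` for the new descent.
-/
theorem fmaj_signedCycle_mul (π : SignedPerm (m + 1))
    (h : ¬(π.perm (Fin.last m) = 0 ∧ π.sgn (Fin.last m) = -1)) :
    (signedCycle m * π).fmaj = π.fmaj + 1 := by
  obtain ⟨p, hp⟩ := π.perm.surjective 0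
  have hneg := neg_signedCycle_mul π hp
  have h1 : (1 : ℤˣ) ≠ -1 := by decide
  have h2 : (-1 : ℤˣ) ≠ 1 := by decide
  unfold fmaj
  rcases Int.units_eq_one_or (π.sgn p) with hs | hs <;>
    simp only [hs, h1, h2, if_true, if_false] at hneg
  · rw [maj_signedCycle_mul_of_pos π hp hs]
    omega
  · have hpm : (p : ℕ) < m := by
      have h3 : p ≠ Fin.last m := by
        rintro rfl
        exact h ⟨hp, hs⟩
      exact Fin.val_lt_last h3
    rw [maj_signedCycle_mul_of_neg π hp hs hpm]
    omega

/-- Appending the letter `n`, for `n = m + 1`, to the word of a signed permutation of `[m]`. -/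
noncomputable def appendMax (σ : SignedPerm m) : SignedPerm (m + 1) :=
  inflate Fin.castSuccOrderEmb σ

theorem appendMax_perm_castSucc (σ : SignedPerm m) (i : Fin m) :
    (appendMax σ).perm i.castSucc = (σ.perm i).castSucc :=
  inflate_perm_apply Fin.castSuccOrderEmb σ i

theorem appendMax_sgn_castSucc (σ : SignedPerm m) (i : Fin m) :
    (appendMax σ).sgn i.castSucc = σ.sgn i :=
  inflate_sgn_apply Fin.castSuccOrderEmb σ i

theorem last_notMem_range_castSucc : Fin.last m ∉ Set.range (Fin.castSuccOrderEmb (n := m)) := by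
  rintro ⟨i, hi⟩
  exact Fin.castSucc_ne_last i hi

theorem appendMax_perm_last (σ : SignedPerm m) : (appendMax σ).perm (Fin.last m) = Fin.last m :=
  inflate_perm_of_notMem _ σ last_notMem_range_castSucc

theorem appendMax_sgn_last (σ : SignedPerm m) : (appendMax σ).sgn (Fin.last m) = 1 :=
  inflate_sgn_of_notMem _ σ last_notMem_range_castSucc

theorem appendMax_injective : Function.Injective (appendMax (m := m)) := by
  intro σ τ h
  ext i
  · have h1 := appendMax_perm_castSucc σ i
    rw [h, appendMax_perm_castSucc, Fin.castSucc_inj] at h1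
    rw [h1]
  · rw [← appendMax_sgn_castSucc σ, h, appendMax_sgn_castSucc]

theorem level_appendMax (σ : SignedPerm m) : (appendMax σ).level = 0 := by
  have h1 : (1 : ℤˣ) ≠ -1 := by decide
  simp [level, appendMax_perm_last, appendMax_sgn_last, h1]

theorem fmaj_appendMax (σ : SignedPerm m) : (appendMax σ).fmaj = σ.fmaj := by
  classical
  have h1 : (1 : ℤˣ) ≠ -1 := by decide
  have hneg : (appendMax σ).neg = σ.neg := by
    rw [neg_eq_sum, neg_eq_sum, Fin.sum_univ_castSucc]
    simp [appendMax_sgn_castSucc, appendMax_sgn_last, h1]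
  have hmaj : (appendMax σ).maj = σ.maj := by
    rw [maj_eq_prefixMaj, maj_eq_prefixMaj]
    cases m with
    | zero => simp [prefixMaj]
    | succ t =>
      have hlast : ¬(appendMax σ).IsDescent t := by
        have h := isDescent_iff (appendMax σ) (a := (Fin.last t).castSucc)
          (b := Fin.last (t + 1)) (by simp)
        rw [appendMax_sgn_last, appendMax_perm_last] at h
        simp only [Fin.val_castSucc, Fin.val_last] at h
        rw [h]
        simp only [h1, false_and, false_or, not_and, not_lt]
        exact fun _ => Fin.le_last _
      rw [prefixMaj_succ_succ, if_neg hlast, add_zero]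
      refine Finset.sum_congr rfl fun j hj => if_congr ?_ rfl rfl
      rw [Finset.mem_range] at hj
      obtain ⟨a, rfl⟩ : ∃ a : Fin (t + 1), (a : ℕ) = j := ⟨⟨j, by omega⟩, rfl⟩
      obtain ⟨b, hb⟩ : ∃ b : Fin (t + 1), (b : ℕ) = a + 1 := ⟨⟨a + 1, by omega⟩, rfl⟩
      have h := isDescent_iff (appendMax σ) (a := a.castSucc) (b := b.castSucc) (by simpa using hb)
      rw [Fin.val_castSucc] at h
      rw [h, isDescent_iff σ hb, appendMax_sgn_castSucc, appendMax_sgn_castSucc,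
        appendMax_perm_castSucc, appendMax_perm_castSucc, Fin.castSucc_lt_castSucc_iff]
  rw [fmaj, fmaj, hneg, hmaj]

theorem level_fmaj_signedCycle_pow_mul (σ : SignedPerm m) {k : ℕ} (hk : k < 2 * (m + 1)) :
    (signedCycle m ^ k * appendMax σ).level = k ∧
      (signedCycle m ^ k * appendMax σ).fmaj = σ.fmaj + k := by
  induction k with
  | zero => simp [level_appendMax, fmaj_appendMax]
  | succ k ih =>
    obtain ⟨h1, h2⟩ := ih (by omega)
    have h3 := not_last_letter_eq_neg_one (signedCycle m ^ k * appendMax σ) (by omega)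
    rw [pow_succ', mul_assoc, level_signedCycle_mul _ h3, fmaj_signedCycle_mul _ h3, h1, h2]
    exact ⟨rfl, by ring⟩

theorem card_signedPerm (n : ℕ) : Fintype.card (SignedPerm n) = n.factorial * 2 ^ n := by
  rw [Fintype.card_congr (equivProd n), Fintype.card_prod, Fintype.card_perm, Fintype.card_fin,
    Fintype.card_fun, Fintype.card_units_int, Fintype.card_fin]

/-- `level` recovers the exponent, which gives injectivity; equality of cardinalities does the rest.
-/
theorem bijective_signedCycle_pow_mul (m : ℕ) : Function.Bijective
    fun p : SignedPerm m × Fin (2 * (m + 1)) => signedCycle m ^ (p.2 : ℕ) * appendMax p.1 := by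
  rw [Fintype.bijective_iff_injective_and_card]
  constructor
  · rintro ⟨σ, k⟩ ⟨τ, l⟩ h
    dsimp only at h
    have hkl : k = l := by
      apply Fin.ext
      rw [← (level_fmaj_signedCycle_pow_mul σ k.2).1, h,
        (level_fmaj_signedCycle_pow_mul τ l.2).1]
    subst hkl
    rw [appendMax_injective (mul_left_cancel h)]
  · rw [Fintype.card_prod, Fintype.card_fin, card_signedPerm, card_signedPerm,
      Nat.factorial_succ]
    ring

variable {R : Type*} [CommRing R] (q : R)

theorem sum_signed_pow_fmaj_succ (m : ℕ) :
    ∑ π : SignedPerm (m + 1), (-1) ^ π.lengthB * q ^ π.fmaj =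
      (∑ k ∈ Finset.range (2 * (m + 1)), ((-1) ^ (m + 1) * q) ^ k) *
        ∑ π : SignedPerm m, (-1) ^ π.lengthB * q ^ π.fmaj := by
  rw [← (bijective_signedCycle_pow_mul m).sum_comp, Fintype.sum_prod_type, Finset.mul_sum]
  refine Finset.sum_congr rfl fun σ _ => ?_
  rw [Finset.sum_range, Finset.sum_mul]
  refine Finset.sum_congr rfl fun k _ => ?_
  dsimp only
  rw [(level_fmaj_signedCycle_pow_mul σ k.2).2, neg_one_pow_lengthB_ring,
    neg_one_pow_lengthB_ring, map_mul, map_pow, signHom_signedCycle, appendMax, signHom_inflate]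
  push_cast
  ring

/-- The signed flag-major generating function of the hyperoctahedral group. -/
theorem sum_signed_pow_fmaj (n : ℕ) :
    ∑ π : SignedPerm n, (-1) ^ π.lengthB * q ^ π.fmaj =
      ∏ i ∈ Finset.range n, ∑ k ∈ Finset.range (2 * (i + 1)), ((-1) ^ (i + 1) * q) ^ k := by
  induction n with
  | zero =>
    have h : (Finset.univ : Finset (SignedPerm 0)) = {1} := by
      ext σ
      simp only [Finset.mem_univ, Finset.mem_singleton, true_iff]
      ext i <;> exact i.elim0
    rw [h, Finset.sum_singleton, neg_one_pow_lengthB_ring, map_one]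
    simp [fmaj, maj, neg]
  | succ m ih => rw [sum_signed_pow_fmaj_succ, ih, Finset.prod_range_succ, mul_comm]

end SignedPerm

/-! ### Inversion of `q`-binomial transforms. -/

section qAnalogues

variable {K : Type*} [Field K]

theorem qInt_add (a b : ℕ) (x : K) : qInt (a + b) x = qInt a x + x ^ a * qInt b x := by
  simp only [qInt, Finset.sum_range_add, pow_add, Finset.mul_sum]

theorem qInt_two_mul (a : ℕ) (q : K) : qInt (2 * a) q = (1 + q) * qInt a (q ^ 2) := by
  induction a with
  | zero => simp [qInt]
  | succ a ih =>
    simp only [qInt, mul_add, mul_one, Finset.sum_range_succ] at ih ⊢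
    rw [ih]
    ring

theorem qFact_zero (x : K) : qFact 0 x = 1 := by simp [qFact]

theorem qFact_succ (m : ℕ) (x : K) : qFact (m + 1) x = qFact m x * qInt (m + 1) x := by
  rw [qFact, Finset.prod_Icc_succ_top (by omega)]
  rfl

theorem evenProd_eq (m : ℕ) (q : K) : evenProd m q = (1 + q) ^ m * qFact m (q ^ 2) := by
  simp [evenProd, qFact, qInt_two_mul, Finset.prod_mul_distrib]

theorem gaussBinom_mul_qFact (x : K) (k m : ℕ) :
    gaussBinom x (k + m) k * (qFact k x * qFact m x) = qFact (k + m) x := by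
  induction h : k + m generalizing k m with
  | zero =>
    obtain ⟨rfl, rfl⟩ : k = 0 ∧ m = 0 := by omega
    simp [qFact_zero]
  | succ n ih =>
    cases k with
    | zero =>
      obtain rfl : m = n + 1 := by omega
      simp [qFact_zero]
    | succ k =>
      cases m with
      | zero =>
        obtain rfl : k = n := by omega
        simp [qFact_zero]
      | succ m =>
        have h1 := ih k (m + 1) (by omega)
        have h2 := ih (k + 1) m (by omega)
        have h3 := qInt_add (k + 1) (m + 1) x
        rw [h] at h3
        rw [gaussBinom_succ_succ, qFact_succ n, h3]
        rw [qFact_succ] at h1 h2 ⊢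
        rw [qFact_succ]
        linear_combination qInt (k + 1) x * h1 + x ^ (k + 1) * qInt (m + 1) x * h2

theorem sum_neg_one_pow_mul_gaussBinom {R : Type*} [CommRing R] (x : R) (n : ℕ) :
    ∑ k ∈ Finset.range (n + 2), (-1) ^ k * x ^ k.choose 2 * gaussBinom x (n + 1) k = 0 := by
  -- By the Pascal rule the alternating sum telescopes along `b`.
  let b : ℕ → R := fun k => (-1) ^ k * x ^ (k + 1).choose 2 * gaussBinom x n k
  have h : ∀ k ∈ Finset.range (n + 1),
      (-1) ^ (k + 1) * x ^ (k + 1).choose 2 * gaussBinom x (n + 1) (k + 1) = b (k + 1) - b k := by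
    intro k _
    simp only [b]
    rw [gaussBinom_succ_succ, Nat.choose_succ_succ' (k + 1) 1, Nat.choose_one_right, pow_add]
    ring
  rw [Finset.sum_range_succ', Finset.sum_congr rfl h, Finset.sum_range_sub]
  simp [b, gaussBinom_eq_zero_of_lt]

theorem qFact_ne_zero {x : K} (hx : ∀ m, 1 ≤ m → qInt m x ≠ 0) (m : ℕ) : qFact m x ≠ 0 :=
  Finset.prod_ne_zero_iff.2 fun i hi => hx i (Finset.mem_Icc.1 hi).1

theorem qBinom_eq_gaussBinom {x : K} (hx : ∀ m, 1 ≤ m → qInt m x ≠ 0) {n k : ℕ} (h : k ≤ n) :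
    qBinom n k x = gaussBinom x n k := by
  obtain ⟨m, rfl⟩ := Nat.exists_eq_add_of_le h
  rw [qBinom, Nat.add_sub_cancel_left, div_eq_iff (mul_ne_zero (qFact_ne_zero hx k)
    (qFact_ne_zero hx m)), gaussBinom_mul_qFact]

/-- The two `q`-exponential series are inverse to each other. -/
theorem qExp_mul_qExp {x : K} (hx : ∀ m, 1 ≤ m → qInt m x ≠ 0) :
    (PowerSeries.mk fun k => (-1) ^ k * x ^ k.choose 2 / qFact k x) *
      (PowerSeries.mk fun m => (qFact m x)⁻¹) = 1 := by
  ext n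
  rw [PowerSeries.coeff_mul, PowerSeries.coeff_one]
  have h : ∀ p ∈ Finset.HasAntidiagonal.antidiagonal n,
      PowerSeries.coeff p.1 (PowerSeries.mk fun k => (-1) ^ k * x ^ k.choose 2 / qFact k x) *
        PowerSeries.coeff p.2 (PowerSeries.mk fun m => (qFact m x)⁻¹) =
      (qFact n x)⁻¹ * ((-1) ^ p.1 * x ^ p.1.choose 2 * gaussBinom x n p.1) := by
    rintro ⟨k, m⟩ hp
    obtain rfl := Finset.HasAntidiagonal.mem_antidiagonal.1 hp
    have h1 := qFact_ne_zero hx k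
    have h2 := qFact_ne_zero hx m
    have h3 := qFact_ne_zero hx (k + m)
    simp only [PowerSeries.coeff_mk]
    field_simp
    linear_combination -x ^ k.choose 2 * gaussBinom_mul_qFact x k m
  rw [Finset.sum_congr rfl h, ← Finset.mul_sum, Finset.Nat.sum_antidiagonal_eq_sum_range_succ_mk]
  cases n with
  | zero => simp [qFact_zero]
  | succ n =>
    rw [sum_neg_one_pow_mul_gaussBinom]
    simp

/-- Inversion of `q`-binomial transforms. -/
theorem gaussBinom_inversion {x : K} (hx : ∀ m, 1 ≤ m → qInt m x ≠ 0) {s d : ℕ → K}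
    (h : ∀ n, s n = ∑ k ∈ Finset.range (n + 1), gaussBinom x n k * d k) (n : ℕ) :
    d n = qFact n x * ∑ k ∈ Finset.range (n + 1),
      (-1) ^ k * x ^ k.choose 2 / qFact k x * (s (n - k) / qFact (n - k) x) := by
  -- After division by `q`-factorials the transform is multiplication by the `q`-exponential series,
  -- which `qExp_mul_qExp` inverts.
  have hs : (PowerSeries.mk fun n => s n / qFact n x) =
      (PowerSeries.mk fun m => (qFact m x)⁻¹) * PowerSeries.mk fun n => d n / qFact n x := by
    rw [mul_comm]
    ext n
    rw [PowerSeries.coeff_mul, PowerSeries.coeff_mk, h,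
      ← Finset.Nat.sum_antidiagonal_eq_sum_range_succ_mk
        (fun p => gaussBinom x n p.1 * d p.1), Finset.sum_div]
    refine Finset.sum_congr rfl ?_
    rintro ⟨k, m⟩ hp
    obtain rfl := Finset.HasAntidiagonal.mem_antidiagonal.1 hp
    have h1 := qFact_ne_zero hx k
    have h2 := qFact_ne_zero hx m
    have h3 := qFact_ne_zero hx (k + m)
    simp only [PowerSeries.coeff_mk]
    field_simp
    linear_combination d k * gaussBinom_mul_qFact x k m
  have hd := congrArg (fun f => PowerSeries.coeff n
    ((PowerSeries.mk fun k => (-1) ^ k * x ^ k.choose 2 / qFact k x) * f)) hs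
  simp only [← mul_assoc, qExp_mul_qExp hx, one_mul, PowerSeries.coeff_mul,
    PowerSeries.coeff_mk] at hd
  rw [Finset.Nat.sum_antidiagonal_eq_sum_range_succ_mk] at hd
  rw [hd, mul_div_cancel₀ _ (qFact_ne_zero hx n)]

end qAnalogues

/-! ### The formula for derangements. -/

namespace SignedPerm

theorem sum_eq_sum_gaussBinom_mul {R : Type*} [CommRing R] (q : R) (n : ℕ) :
    ∑ π : SignedPerm n, (-1) ^ π.lengthB * q ^ π.fmaj =
      ∑ k ∈ Finset.range (n + 1), gaussBinom (q ^ 2) n k *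
        ∑ σ ∈ derangements k, (-1) ^ σ.lengthB * q ^ σ.fmaj := by
  rw [← Finset.sum_fiberwise_of_maps_to
    (t := (Finset.range (n + 1)).sigma fun k => derangements k)
    (g := fun π : SignedPerm n => (⟨π.nonfixed.card, π.dp⟩ : Σ m, SignedPerm m))]
  · rw [Finset.sum_sigma]
    refine Finset.sum_congr rfl fun k _ => ?_
    rw [Finset.mul_sum]
    refine Finset.sum_congr rfl fun σ hσ => ?_
    rw [sum_signed_pow_fmaj_of_dp_eq q hσ, mul_comm]
  · intro π _
    rw [Finset.mem_sigma, Finset.mem_range]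
    exact ⟨Nat.lt_succ_of_le ((Finset.card_le_univ π.nonfixed).trans_eq (Fintype.card_fin n)),
      π.dp_mem_derangements⟩

variable {K : Type*} [Field K]

/-- The factor for even `i` is `[2i]_q`; for odd `i` it is `[2i]` at `-q`, which is `(1 - q)/(1 +
q)` times `[2i]_q`. The exponent `(n + 1) / 2` counts the odd `i ≤ n`. -/
theorem sum_signed_pow_fmaj_eq_evenProd {q : K} (hq : 1 + q ≠ 0) (n : ℕ) :
    ∑ π : SignedPerm n, (-1) ^ π.lengthB * q ^ π.fmaj =
      evenProd n q * ((1 - q) / (1 + q)) ^ ((n + 1) / 2) := by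
  rw [sum_signed_pow_fmaj]
  induction n with
  | zero => simp [evenProd]
  | succ n ih =>
    rw [Finset.prod_range_succ, ih, evenProd_eq, evenProd_eq, qFact_succ]
    change _ * qInt (2 * (n + 1)) ((-1) ^ (n + 1) * q) = _
    rw [qInt_two_mul, mul_pow, ← pow_mul, mul_comm (n + 1) 2, pow_mul (-1 : K) 2, neg_one_sq,
      one_pow, one_mul]
    rcases Nat.even_or_odd n with h | h
    · have h1 : (n + 1 + 1) / 2 = (n + 1) / 2 + 1 := by
        obtain ⟨t, rfl⟩ := h
        omega
      rw [h1, h.add_one.neg_one_pow, pow_succ _ ((n + 1) / 2), pow_succ (1 + q)]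
      generalize ((1 - q) / (1 + q)) ^ ((n + 1) / 2) = r
      field_simp
      ring
    · have h1 : (n + 1 + 1) / 2 = (n + 1) / 2 := by
        obtain ⟨t, rfl⟩ := h
        omega
      rw [h1, h.add_one.neg_one_pow]
      ring

theorem sum_derangements_signed_pow_fmaj {q : K} (hq : 1 + q ≠ 0)
    (hx : ∀ m, 1 ≤ m → qInt m (q ^ 2) ≠ 0) (n : ℕ) :
    ∑ σ ∈ derangements n, (-1) ^ σ.lengthB * q ^ σ.fmaj =
      evenProd n q * ∑ k ∈ Finset.range (n + 1),
        (-1) ^ k * q ^ (2 * k.choose 2) / evenProd k q *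
          ((1 - q) / (1 + q)) ^ ((n - k + 1) / 2) := by
  rw [gaussBinom_inversion hx (sum_eq_sum_gaussBinom_mul q) n, Finset.mul_sum, Finset.mul_sum]
  refine Finset.sum_congr rfl fun k hk => ?_
  obtain ⟨m, rfl⟩ := Nat.exists_eq_add_of_le (Nat.lt_succ_iff.1 (Finset.mem_range.1 hk))
  have h1 := qFact_ne_zero hx k
  have h2 := qFact_ne_zero hx m
  rw [Nat.add_sub_cancel_left, sum_signed_pow_fmaj_eq_evenProd hq, evenProd_eq, evenProd_eq,
    evenProd_eq, pow_mul q 2]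
  generalize ((1 - q) / (1 + q)) ^ ((m + 1) / 2) = r
  field_simp
  ring

end SignedPerm

theorem qInt_ratFunc_X_sq_ne_zero (m : ℕ) (hm : 1 ≤ m) :
    qInt m ((RatFunc.X : RatFunc ℚ) ^ 2) ≠ 0 := by
  have h : qInt m ((RatFunc.X : RatFunc ℚ) ^ 2) = algebraMap (Polynomial ℚ) (RatFunc ℚ)
      (∑ i ∈ Finset.range m, (Polynomial.X ^ 2) ^ i) := by
    simp [qInt, RatFunc.algebraMap_X]
  rw [h]
  intro h0
  -- At `1` the polynomial takes the value `m`.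
  have h1 := congrArg (Polynomial.eval 1)
    ((map_eq_zero_iff _ (RatFunc.algebraMap_injective ℚ)).1 h0)
  simp [Polynomial.eval_finsetSum] at h1
  omega

theorem one_add_ratFunc_X_ne_zero : 1 + (RatFunc.X : RatFunc ℚ) ≠ 0 := by
  have h : 1 + (RatFunc.X : RatFunc ℚ) =
      algebraMap (Polynomial ℚ) (RatFunc ℚ) (1 + Polynomial.X) := by
    simp [RatFunc.algebraMap_X]
  rw [h]
  intro h0
  have h1 := congrArg (Polynomial.eval 1)
    ((map_eq_zero_iff _ (RatFunc.algebraMap_injective ℚ)).1 h0)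
  norm_num at h1

theorem mainTheorem4 (n : ℕ) (q : RatFunc ℚ) (hq : q = RatFunc.X) :
    (1 ≤ n →
      ∑ σ ∈ SignedPerm.derangements n, (-1) ^ σ.lengthB * q ^ σ.fmaj =
        evenProd n q * ∑ k ∈ Finset.range (n + 1),
          (-1) ^ k * q ^ (2 * k.choose 2) / evenProd k q *
            ((1 - q) / (1 + q)) ^ ((n - k + 1) / 2)) ∧
    (∀ π : SignedPerm n, π.lengthB ≡ π.dp.lengthB [MOD 2]) ∧
    (∀ k ≤ n, ∀ σ ∈ SignedPerm.derangements k,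
      ∑ π : SignedPerm n with
          (⟨π.nonfixed.card, π.dp⟩ : Σ m, SignedPerm m) = ⟨k, σ⟩,
        (-1) ^ π.lengthB * q ^ π.fmaj =
          (-1) ^ σ.lengthB * q ^ σ.fmaj * qBinom n k (q ^ 2)) := by
  subst hq
  refine ⟨fun _ => SignedPerm.sum_derangements_signed_pow_fmaj one_add_ratFunc_X_ne_zero
    qInt_ratFunc_X_sq_ne_zero n, SignedPerm.lengthB_dp_modEq, fun k hk σ hσ => ?_⟩
  rw [qBinom_eq_gaussBinom qInt_ratFunc_X_sq_ne_zero hk,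
    SignedPerm.sum_signed_pow_fmaj_of_dp_eq _ hσ]
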